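/- **Setting.** Let $\mathbf M$ and $\mathbf Q$ be small symmetric monoidal categories with the same objects, the same tensor product on objects and the same unit $I$, and let $J:\mathbf M\to\mathbf Q$ be a strict symmetric monoidal functor that is the identity on objects. Assume that in $\mathbf Q$ the tensor product distributes over the binary coproducts that exist in $\mathbf Q$: if $A+B$ exists, then $(A+B)\otimes X$ is a coproduct of $A\otimes X$ and $B\otimes X$. Let $\mathcal V$ be the cartesian closed category of bisets: objects are functions $X_1\to X_0$ of sets, morphisms are commutative squares. Let $\mathbf C$ be the $\mathcal V$-category with the objects of $\mathbf Q$ and hom-objects $\mathbf C(A,B)=\big(J:\mathbf M(A,B)\to\mathbf Q(A,B)\big)$, and let $\overline{\mathbf C}=\mathcal V^{\mathbf C^{op}}$ be the $\mathcal V$-category of $\mathcal V$-functors $\mathbf C^{op}\to\mathcal V$, with the Day convolution $(F\otimes_{Day}G)(C)=\int^{A,B}\mathbf C(C,A\otimes B)\times FA\times GB$ and unit $\mathbf C(-,I)$. A $\mathcal V$-functor $F:\mathbf C^{op}\to\mathcal V$ amounts to functors $F^0:\mathbf Q^{op}\to\mathbf{Set}$, $F^1:\mathbf M^{op}\to\mathbf{Set}$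 and a natural transformation $h:F^1\to F^0\circ J^{op}$. Call $F$ *smooth* if $F^0$ preserves the binary products that exist in $\mathbf Q^{op}$, i.e. $F^0(A+B)\cong F^0A\times F^0B$ canonically whenever $A+B$ exists in $\mathbf Q$. Let $i:\widetilde{\mathbf C}\hookrightarrow\overline{\mathbf C}$ be the full $\mathcal V$-subcategory of smooth functors. It has the reflection $\widetilde L:\overline{\mathbf C}\to\widetilde{\mathbf C}$, $(\widetilde LF)(A)=\big((F A)_1\to (FA)_0\to (LF^0)(A)\big)$, where $L$ is the left adjoint of the inclusion of the product-preserving functors into $\mathbf{Set}^{\mathbf Q^{op}}$; write $\eta^L:\mathrm{id}\to i\widetilde L$ and $\varepsilon:\widetilde Li\to\mathrm{id}$ for its unit and counit. Equip $\widetilde{\mathbf C}$ with the tensor product $F\otimes G=\widetilde L(iF\otimes_{Day}iG)$, the unit $\mathbf C(-,I)$, the unitors and the symmetry obtained from those of Day convolution by applying $\widetilde L$ (followed by $\varepsilon$ for the unitors), and the associator $a$ determined by $a\circ\widetilde L(\eta^L\otimes_{Day} iH)=\widetilde L(iF\otimes_{Day}\eta^L)\circ\widetilde L\alpha$, with $\alpha$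 the associator of Day convolution. Regard $\mathbf{Set}$ as a $\mathcal V$-category with hom-objects $\big(\mathrm{id}:\mathbf{Set}(X,Y)\to\mathbf{Set}(X,Y)\big)$, and let $U_0:\mathcal V\to\mathbf{Set}$, $U_0(X_1\to X_0)=X_0$, and its right adjoint $\Delta:\mathbf{Set}\to\mathcal V$, $\Delta S=(\mathrm{id}:S\to S)$, be the evident $\mathcal V$-functors. Composition with them gives $\overline{U}_0$ and $\overline\Delta$ between $\overline{\mathbf C}$ and $\mathbf{Set}^{\mathbf C^{op}}$, and $\overline T=\overline\Delta\circ\overline U_0$. The Day strength $\overline t_{F,G}:F\otimes_{Day}\overline TG\to\overline T(F\otimes_{Day}G)$ is induced on coends by the strength of the monad $\Delta U_0$ on $\mathcal V$. The functors $\overline U_0$ and $\overline\Delta$ restrict to smooth functors; let $\overline U_0'$ and $\overline\Delta'$ be the restrictions and $\widetilde T=\overline\Delta'\circ\overline U_0':\widetilde{\mathbf C}\to\widetilde{\mathbf C}$, with the unit $\widetilde\eta$ and multiplication $\widetilde\mu$ given by the adjunction $\overline U_0'\dashv\overline\Delta'$. Let $\beta: i\widetilde T\to\overline Ti$ be the canonical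 (identity) isomorphism, and set $$\rho_F=\Big(\widetilde L\overline TF\xrightarrow{\widetilde L\overline T\eta^L}\widetilde L\overline Ti\widetilde LF\xrightarrow{\widetilde L\beta^{-1}}\widetilde Li\widetilde T\widetilde LF\xrightarrow{\ \varepsilon\ }\widetilde T\widetilde LF\Big),$$ $$\widetilde t_{F,G}=\Big(F\otimes\widetilde TG=\widetilde L(iF\otimes_{Day} i\widetilde TG)\xrightarrow{\widetilde L(iF\otimes\beta)}\widetilde L(iF\otimes_{Day}\overline TiG)\xrightarrow{\widetilde L\overline t}\widetilde L\overline T(iF\otimes_{Day}iG)\xrightarrow{\ \rho\ }\widetilde T(F\otimes G)\Big).$$ **Theorem.** With this structure $\widetilde{\mathbf C}$ is a symmetric monoidal $\mathcal V$-category, and $(\widetilde T,\widetilde\eta,\widetilde\mu,\widetilde t)$ is a commutative strong $\mathcal V$-monad on it. That is: $(\widetilde T,\widetilde\eta,\widetilde\mu)$ is a $\mathcal V$-monad; $\widetilde t$ is $\mathcal V$-natural in both arguments and compatible with $\widetilde\eta$, $\widetilde\mu$, the associator and the left unitor; and, with the costrength $\widetilde s_{F,G}=\widetilde T\gamma\circ\widetilde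 t_{G,F}\circ\gamma:\widetilde TF\otimes G\to\widetilde T(F\otimes G)$ obtained from the symmetry $\gamma$, $$\widetilde\mu\circ\widetilde T\widetilde t_{F,G}\circ\widetilde s_{F,\widetilde TG}=\widetilde\mu\circ\widetilde T\widetilde s_{F,G}\circ\widetilde t_{\widetilde TF,G}:\ \widetilde TF\otimes\widetilde TG\to\widetilde T(F\otimes G).$$ -/

import Mathlib

open CategoryTheory MonoidalCategory Opposite Limits

universe w v u u₁ u₂ u₃

set_option linter.unusedVariables false

section EnrichedNotions

variable (V : Type v) [Category.{w} V] [MonoidalCategory V]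

/-- A map `X → Y` in a `V`-category: a morphism `I ⟶ A(X, Y)` of `V`. -/
abbrev EMap {A : Type u₁} [EnrichedCategory V A] (X Y : A) : Type w := 𝟙_ V ⟶ (X ⟶[V] Y)

variable {V}

namespace EMap

variable {A : Type u₁} [EnrichedCategory V A] {B : Type u₂} [EnrichedCategory V B]

/-- Composition of maps (in diagrammatic order). -/
def comp {X Y Z : A} (f : EMap V X Y) (g : EMap V Y Z) : EMap V X Z :=
  (λ_ (𝟙_ V)).inv ≫ (f ⊗ₘ g) ≫ eComp V X Y Z

/-- `A(X, g) : A(X, Y) ⟶ A(X, Z)`. -/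
def post (X : A) {Y Z : A} (g : EMap V Y Z) : (X ⟶[V] Y) ⟶ (X ⟶[V] Z) :=
  (ρ_ _).inv ≫ (_ ◁ g) ≫ eComp V X Y Z

/-- `A(f, Z) : A(Y, Z) ⟶ A(X, Z)`. -/
def pre {X Y : A} (f : EMap V X Y) (Z : A) : (Y ⟶[V] Z) ⟶ (X ⟶[V] Z) :=
  (λ_ _).inv ≫ (f ▷ _) ≫ eComp V X Y Z

/-- The action of a `V`-functor on maps. -/
def image (F : EnrichedFunctor V A B) {X Y : A} (f : EMap V X Y) : EMap V (F.obj X) (F.obj Y) :=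
  f ≫ F.map X Y

/-- A map is an isomorphism if it has a two-sided inverse. -/
def IsInvertible {X Y : A} (f : EMap V X Y) : Prop :=
  ∃ g : EMap V Y X, f.comp g = eId V X ∧ g.comp f = eId V Y

end EMap

/-- `V`-naturality of a family of maps `F X → G X`. -/
def IsVNatural {A : Type u₁} [EnrichedCategory V A] {B : Type u₂} [EnrichedCategory V B]
    (F G : EnrichedFunctor V A B) (α : ∀ X, EMap V (F.obj X) (G.obj X)) : Prop :=
  ∀ X Y, F.map X Y ≫ EMap.post _ (α Y) = G.map X Y ≫ EMap.pre (α X) _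

variable (V) in
/-- The data of a symmetric monoidal structure on a `V`-category. -/
structure TensorData (A : Type u₁) [EnrichedCategory V A] where
  unit : A
  obj : A → A → A
  hom (X₁ X₂ Y₁ Y₂ : A) : (X₁ ⟶[V] Y₁) ⊗ (X₂ ⟶[V] Y₂) ⟶ (obj X₁ X₂ ⟶[V] obj Y₁ Y₂)
  assoc (X Y Z : A) : EMap V (obj (obj X Y) Z) (obj X (obj Y Z))
  leftUnitor (X : A) : EMap V (obj unit X) X
  rightUnitor (X : A) : EMap V (obj X unit) X
  braiding (X Y : A) : EMap V (obj X Y) (obj Y X)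

/-- The tensor product `f ⊗ g` of two maps. -/
def TensorData.tensorMap {A : Type u₁} [EnrichedCategory V A] (D : TensorData V A)
    {X₁ X₂ Y₁ Y₂ : A} (f : EMap V X₁ Y₁) (g : EMap V X₂ Y₂) :
    EMap V (D.obj X₁ X₂) (D.obj Y₁ Y₂) :=
  (λ_ (𝟙_ V)).inv ≫ (f ⊗ₘ g) ≫ D.hom X₁ X₂ Y₁ Y₂

/-- The laws of a symmetric monoidal `V`-category. -/
structure TensorData.IsSymmetricMonoidal [BraidedCategory V] {A : Type u₁} [EnrichedCategory V A]
    (D : TensorData V A) : Prop where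
  tensor_id (X Y : A) : D.tensorMap (eId V X) (eId V Y) = eId V (D.obj X Y)
  tensor_comp (X₁ X₂ Y₁ Y₂ Z₁ Z₂ : A) :
    tensorμ (X₁ ⟶[V] Y₁) (X₂ ⟶[V] Y₂) (Y₁ ⟶[V] Z₁) (Y₂ ⟶[V] Z₂) ≫
        (eComp V X₁ Y₁ Z₁ ⊗ₘ eComp V X₂ Y₂ Z₂) ≫ D.hom X₁ X₂ Z₁ Z₂ =
      (D.hom X₁ X₂ Y₁ Y₂ ⊗ₘ D.hom Y₁ Y₂ Z₁ Z₂) ≫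
        eComp V (D.obj X₁ X₂) (D.obj Y₁ Y₂) (D.obj Z₁ Z₂)
  assoc_natural (X₁ X₂ X₃ Y₁ Y₂ Y₃ : A) :
    (D.hom X₁ X₂ Y₁ Y₂ ▷ (X₃ ⟶[V] Y₃)) ≫ D.hom _ X₃ _ Y₃ ≫ EMap.post _ (D.assoc Y₁ Y₂ Y₃) =
      (α_ _ _ _).hom ≫ ((X₁ ⟶[V] Y₁) ◁ D.hom X₂ X₃ Y₂ Y₃) ≫ D.hom X₁ _ Y₁ _ ≫
        EMap.pre (D.assoc X₁ X₂ X₃) _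
  leftUnitor_natural (X Y : A) :
    (λ_ (X ⟶[V] Y)).inv ≫ (eId V D.unit ▷ _) ≫ D.hom _ _ _ _ ≫ EMap.post _ (D.leftUnitor Y) =
      EMap.pre (D.leftUnitor X) Y
  rightUnitor_natural (X Y : A) :
    (ρ_ (X ⟶[V] Y)).inv ≫ (_ ◁ eId V D.unit) ≫ D.hom _ _ _ _ ≫ EMap.post _ (D.rightUnitor Y) =
      EMap.pre (D.rightUnitor X) Y
  braiding_natural (X₁ X₂ Y₁ Y₂ : A) :
    D.hom X₁ X₂ Y₁ Y₂ ≫ EMap.post _ (D.braiding Y₁ Y₂) =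
      (β_ (X₁ ⟶[V] Y₁) (X₂ ⟶[V] Y₂)).hom ≫ D.hom X₂ X₁ Y₂ Y₁ ≫ EMap.pre (D.braiding X₁ X₂) _
  assoc_invertible (X Y Z : A) : (D.assoc X Y Z).IsInvertible
  leftUnitor_invertible (X : A) : (D.leftUnitor X).IsInvertible
  rightUnitor_invertible (X : A) : (D.rightUnitor X).IsInvertible
  symmetry (X Y : A) : (D.braiding X Y).comp (D.braiding Y X) = eId V (D.obj X Y)
  pentagon (W X Y Z : A) :
    ((D.tensorMap (D.assoc W X Y) (eId V Z)).comp (D.assoc W (D.obj X Y) Z)).comp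
        (D.tensorMap (eId V W) (D.assoc X Y Z)) =
      (D.assoc (D.obj W X) Y Z).comp (D.assoc W X (D.obj Y Z))
  triangle (X Y : A) :
    (D.assoc X D.unit Y).comp (D.tensorMap (eId V X) (D.leftUnitor Y)) =
      D.tensorMap (D.rightUnitor X) (eId V Y)
  hexagon (X Y Z : A) :
    ((D.assoc X Y Z).comp (D.braiding X (D.obj Y Z))).comp (D.assoc Y Z X) =
      ((D.tensorMap (D.braiding X Y) (eId V Z)).comp (D.assoc Y X Z)).comp
        (D.tensorMap (eId V Y) (D.braiding X Z))

/-- `(T, η, μ)` is a `V`-monad. -/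
structure IsVMonad {A : Type u₁} [EnrichedCategory V A] (T : EnrichedFunctor V A A)
    (η : ∀ X, EMap V X (T.obj X)) (μ : ∀ X, EMap V (T.obj (T.obj X)) (T.obj X)) : Prop where
  unit_natural : IsVNatural (EnrichedFunctor.id V A) T η
  mul_natural : IsVNatural (T.comp V T) T μ
  assoc (X : A) : ((μ X).image T).comp (μ X) = (μ (T.obj X)).comp (μ X)
  left_unit (X : A) : (η (T.obj X)).comp (μ X) = eId V (T.obj X)
  right_unit (X : A) : ((η X).image T).comp (μ X) = eId V (T.obj X)

/-- `t : X ⊗ T Y → T (X ⊗ Y)` is a strength for the `V`-monad `(T, η, μ)`. -/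
structure IsStrength {A : Type u₁} [EnrichedCategory V A] (D : TensorData V A)
    (T : EnrichedFunctor V A A) (η : ∀ X, EMap V X (T.obj X))
    (μ : ∀ X, EMap V (T.obj (T.obj X)) (T.obj X))
    (t : ∀ X Y, EMap V (D.obj X (T.obj Y)) (T.obj (D.obj X Y))) : Prop where
  natural (X₁ X₂ Y₁ Y₂ : A) :
    ((X₁ ⟶[V] Y₁) ◁ T.map X₂ Y₂) ≫ D.hom X₁ (T.obj X₂) Y₁ (T.obj Y₂) ≫ EMap.post _ (t Y₁ Y₂) =
      D.hom X₁ X₂ Y₁ Y₂ ≫ T.map _ _ ≫ EMap.pre (t X₁ X₂) _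
  unit (X Y : A) : (D.tensorMap (eId V X) (η Y)).comp (t X Y) = η (D.obj X Y)
  mul (X Y : A) :
    ((t X (T.obj Y)).comp ((t X Y).image T)).comp (μ (D.obj X Y)) =
      (D.tensorMap (eId V X) (μ Y)).comp (t X Y)
  assoc (X Y Z : A) :
    (t (D.obj X Y) Z).comp ((D.assoc X Y Z).image T) =
      ((D.assoc X Y (T.obj Z)).comp (D.tensorMap (eId V X) (t Y Z))).comp (t X (D.obj Y Z))
  leftUnitor (X : A) :
    (t D.unit X).comp ((D.leftUnitor X).image T) = D.leftUnitor (T.obj X)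

/-- The costrength `T X ⊗ Y → T (X ⊗ Y)` obtained from a strength and the symmetry. -/
def costrength {A : Type u₁} [EnrichedCategory V A] (D : TensorData V A)
    (T : EnrichedFunctor V A A) (t : ∀ X Y, EMap V (D.obj X (T.obj Y)) (T.obj (D.obj X Y)))
    (X Y : A) : EMap V (D.obj (T.obj X) Y) (T.obj (D.obj X Y)) :=
  ((D.braiding (T.obj X) Y).comp (t Y X)).comp ((D.braiding Y X).image T)

/-- `(T, η, μ, t)` is a commutative strong `V`-monad on a `V`-category with tensor data `D`. -/
structure IsCommutativeStrongVMonad {A : Type u₁} [EnrichedCategory V A] (D : TensorData V A)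
    (T : EnrichedFunctor V A A) (η : ∀ X, EMap V X (T.obj X))
    (μ : ∀ X, EMap V (T.obj (T.obj X)) (T.obj X))
    (t : ∀ X Y, EMap V (D.obj X (T.obj Y)) (T.obj (D.obj X Y))) : Prop where
  monad : IsVMonad T η μ
  strength : IsStrength D T η μ t
  commutative (X Y : A) :
    ((costrength D T t X (T.obj Y)).comp ((t X Y).image T)).comp (μ (D.obj X Y)) =
      ((t (T.obj X) Y).comp ((costrength D T t X Y).image T)).comp (μ (D.obj X Y))

/-- A full `V`-subcategory: the objects of `A` satisfying `P`, with the hom-objects of `A`. -/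
structure FullSub {A : Type u₁} (P : A → Prop) where
  obj : A
  prop : P obj

instance {A : Type u₁} [EnrichedCategory V A] (P : A → Prop) :
    EnrichedCategory V (FullSub P) where
  Hom X Y := X.obj ⟶[V] Y.obj
  id X := eId V X.obj
  comp X Y Z := eComp V X.obj Y.obj Z.obj
  id_comp X Y := e_id_comp V X.obj Y.obj
  comp_id X Y := e_comp_id V X.obj Y.obj
  assoc W X Y Z := e_assoc V W.obj X.obj Y.obj Z.obj

/-- The inclusion of a full `V`-subcategory. -/
def FullSub.incl {A : Type u₁} [EnrichedCategory V A] (P : A → Prop) :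
    EnrichedFunctor V (FullSub P) A where
  obj X := X.obj
  map X Y := 𝟙 (X.obj ⟶[V] Y.obj)
  map_id _ := Category.comp_id _
  map_comp X Y Z := by
    refine (Category.comp_id (eComp V X.obj Y.obj Z.obj)).trans ?_
    exact ((congrArg (· ≫ eComp V X.obj Y.obj Z.obj)
      (id_tensorHom_id (X.obj ⟶[V] Y.obj) (Y.obj ⟶[V] Z.obj))).trans (Category.id_comp _)).symm

/-- The restriction of a `V`-functor to full `V`-subcategories. -/
def FullSub.restrict {A : Type u₁} [EnrichedCategory V A] {B : Type u₂} [EnrichedCategory V B]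
    {P : A → Prop} {R : B → Prop} (F : EnrichedFunctor V A B) (h : ∀ X, P X → R (F.obj X)) :
    EnrichedFunctor V (FullSub P) (FullSub R) where
  obj X := ⟨F.obj X.obj, h _ X.prop⟩
  map X Y := F.map X.obj Y.obj
  map_id X := F.map_id X.obj
  map_comp X Y Z := F.map_comp X.obj Y.obj Z.obj

end EnrichedNotions

/-- A biset: sets `X₀`, `X₁` and a function `X₁ → X₀`. -/
structure Biset : Type (u + 1) where
  zero : Type u
  one : Type u
  map : one → zero

namespace Biset

/-- A morphism of bisets: a commutative square. -/
@[ext]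
structure Hom (X Y : Biset.{u}) : Type u where
  zero : X.zero → Y.zero
  one : X.one → Y.one
  comm (x : X.one) : Y.map (one x) = zero (X.map x)

instance : Category Biset.{u} where
  Hom := Hom
  id X := ⟨fun x => x, fun x => x, fun _ => rfl⟩
  comp f g := ⟨fun x => g.zero (f.zero x), fun x => g.one (f.one x),
    fun x => (g.comm _).trans (congrArg g.zero (f.comm x))⟩

@[ext]
theorem hom_ext {X Y : Biset.{u}} {f g : X ⟶ Y} (h₀ : ∀ x, Hom.zero f x = Hom.zero g x)
    (h₁ : ∀ x, Hom.one f x = Hom.one g x) : f = g :=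
  Hom.ext (funext h₀) (funext h₁)

/-- The product of bisets. -/
def prod (X Y : Biset.{u}) : Biset.{u} :=
  ⟨X.zero × Y.zero, X.one × Y.one, fun p => (X.map p.1, Y.map p.2)⟩

/-- The terminal biset. -/
def terminal : Biset.{u} := ⟨PUnit, PUnit, fun _ => PUnit.unit⟩

/-- The product of two morphisms. -/
def prodMap {X Y X' Y' : Biset.{u}} (f : X ⟶ X') (g : Y ⟶ Y') : prod X Y ⟶ prod X' Y' :=
  ⟨fun p => (Hom.zero f p.1, Hom.zero g p.2), fun p => (Hom.one f p.1, Hom.one g p.2),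
    fun p => Prod.ext (Hom.comm f p.1) (Hom.comm g p.2)⟩

/-- The cartesian monoidal structure on bisets. -/
instance : MonoidalCategoryStruct Biset.{u} where
  tensorObj := prod
  tensorUnit := terminal
  tensorHom := prodMap
  whiskerLeft X _ _ g := prodMap (𝟙 X) g
  whiskerRight f Y := prodMap f (𝟙 Y)
  associator X Y Z :=
    { hom := ⟨fun p => (p.1.1, (p.1.2, p.2)), fun p => (p.1.1, (p.1.2, p.2)), fun _ => rfl⟩
      inv := ⟨fun p => ((p.1, p.2.1), p.2.2), fun p => ((p.1, p.2.1), p.2.2), fun _ => rfl⟩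
      hom_inv_id := rfl
      inv_hom_id := rfl }
  leftUnitor X :=
    { hom := ⟨fun p => p.2, fun p => p.2, fun _ => rfl⟩
      inv := ⟨fun p => (PUnit.unit, p), fun p => (PUnit.unit, p), fun _ => rfl⟩
      hom_inv_id := rfl
      inv_hom_id := rfl }
  rightUnitor X :=
    { hom := ⟨fun p => p.1, fun p => p.1, fun _ => rfl⟩
      inv := ⟨fun p => (p, PUnit.unit), fun p => (p, PUnit.unit), fun _ => rfl⟩
      hom_inv_id := rfl
      inv_hom_id := rfl }

instance : MonoidalCategory Biset.{u} :=
  MonoidalCategory.ofTensorHom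
    (id_tensorHom_id := fun _ _ => rfl)
    (id_tensorHom := fun _ _ _ _ => rfl)
    (tensorHom_id := fun _ _ => rfl)
    (tensorHom_comp_tensorHom := fun _ _ _ _ => rfl)
    (associator_naturality := fun _ _ _ => rfl)
    (leftUnitor_naturality := fun _ => rfl)
    (rightUnitor_naturality := fun _ => rfl)
    (pentagon := fun _ _ _ _ => rfl)
    (triangle := fun _ _ => rfl)

instance : SymmetricCategory Biset.{u} where
  braiding X Y :=
    { hom := ⟨fun p => (p.2, p.1), fun p => (p.2, p.1), fun _ => rfl⟩
      inv := ⟨fun p => (p.2, p.1), fun p => (p.2, p.1), fun _ => rfl⟩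
      hom_inv_id := rfl
      inv_hom_id := rfl }
  braiding_naturality_right _ _ _ _ := rfl
  braiding_naturality_left _ _ := rfl
  hexagon_forward _ _ _ := rfl
  hexagon_reverse _ _ _ := rfl
  symmetry _ _ := rfl

/-- The global element `1 ⟶ X` given by an element of `X₁`. -/
def point {X : Biset.{u}} (x : X.one) : 𝟙_ Biset.{u} ⟶ X :=
  ⟨fun _ => X.map x, fun _ => x, fun _ => rfl⟩

/-- Bisets as a `Biset`-category: the hom-object is the exponential `X ⇒ Y`, with
`(X ⇒ Y)₀ = Set(X₀, Y₀)` and `(X ⇒ Y)₁ = Hom(X, Y)`. -/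
instance selfEnriched : EnrichedCategory Biset.{u} Biset.{u} where
  Hom X Y := ⟨X.zero → Y.zero, X ⟶ Y, fun f => Hom.zero f⟩
  id X := ⟨fun _ x => x, fun _ => 𝟙 X, fun _ => rfl⟩
  comp X Y Z := ⟨fun p x => p.2 (p.1 x), fun p => p.1 ≫ p.2, fun _ => rfl⟩
  id_comp _ _ := rfl
  comp_id _ _ := rfl
  assoc _ _ _ _ := rfl

/-- `Set` as a `Biset`-category, with hom-objects `(Set(X, Y), Set(X, Y), id)`. -/
instance setEnriched : EnrichedCategory Biset.{u} (Type u) where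
  Hom X Y := ⟨X → Y, X → Y, fun f => f⟩
  id X := ⟨fun _ x => x, fun _ x => x, fun _ => rfl⟩
  comp X Y Z := ⟨fun p x => p.2 (p.1 x), fun p x => p.2 (p.1 x), fun _ => rfl⟩
  id_comp _ _ := rfl
  comp_id _ _ := rfl
  assoc _ _ _ _ := rfl

/-- The `Biset`-functor `U₀(X) = X₀`. -/
def U₀ : EnrichedFunctor Biset.{u} Biset.{u} (Type u) where
  obj X := X.zero
  map X Y := ⟨fun f => f, fun f => Hom.zero f, fun _ => rfl⟩
  map_id _ := rfl
  map_comp _ _ _ := rfl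

/-- The `Biset`-functor `Δ(X) = (X, X, id)`. -/
def Δ : EnrichedFunctor Biset.{u} (Type u) Biset.{u} where
  obj X := ⟨X, X, fun x => x⟩
  map X Y := ⟨fun f => f, fun f => ⟨f, f, fun _ => rfl⟩, fun _ => rfl⟩
  map_id _ := rfl
  map_comp _ _ _ := rfl

end Biset

section DayConvolution

variable {K : Type u} [Category.{u} K] [MonoidalCategory K]

/-- A generator of `∫^{a,b} K(c, a ⊗ b) × P a × R b`. -/
structure DayGen (P R : Kᵒᵖ ⥤ Type u) (c : K) : Type u where
  left : K
  right : K
  arrow : c ⟶ left ⊗ right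
  x : P.obj (op left)
  y : R.obj (op right)

/-- The relations of the coend `∫^{a,b} K(c, a ⊗ b) × P a × R b`. -/
inductive DayRel (P R : Kᵒᵖ ⥤ Type u) (c : K) : DayGen P R c → DayGen P R c → Prop
  | glide {a a' b b' : K} (f : c ⟶ a ⊗ b) (s : a ⟶ a') (t : b ⟶ b')
      (x : P.obj (op a')) (y : R.obj (op b')) :
      DayRel P R c ⟨a', b', f ≫ (s ⊗ₘ t), x, y⟩ ⟨a, b, f, P.map s.op x, R.map t.op y⟩

/-- The coend `∫^{a,b} K(c, a ⊗ b) × P a × R b`. -/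
def DayObj (P R : Kᵒᵖ ⥤ Type u) (c : K) : Type u := Quot (DayRel P R c)

/-- The class of a generator. -/
def DayObj.mk {P R : Kᵒᵖ ⥤ Type u} {c a b : K} (f : c ⟶ a ⊗ b) (x : P.obj (op a))
    (y : R.obj (op b)) : DayObj P R c :=
  Quot.mk _ ⟨a, b, f, x, y⟩

theorem DayObj.glide {P R : Kᵒᵖ ⥤ Type u} {c a a' b b' : K} (f : c ⟶ a ⊗ b) (s : a ⟶ a')
    (t : b ⟶ b') (x : P.obj (op a')) (y : R.obj (op b')) :
    DayObj.mk (f ≫ (s ⊗ₘ t)) x y = DayObj.mk f (P.map s.op x) (R.map t.op y) :=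
  Quot.sound (DayRel.glide f s t x y)

theorem DayObj.ind {P R : Kᵒᵖ ⥤ Type u} {c : K} {p : DayObj P R c → Prop}
    (h : ∀ {a b : K} (f : c ⟶ a ⊗ b) (x : P.obj (op a)) (y : R.obj (op b)), p (DayObj.mk f x y))
    (q : DayObj P R c) : p q :=
  Quot.ind (fun g => h g.arrow g.x g.y) q

/-- Functions out of the coend. -/
def DayObj.lift {P R : Kᵒᵖ ⥤ Type u} {c : K} {S : Type u}
    (φ : ∀ {a b : K}, (c ⟶ a ⊗ b) → P.obj (op a) → R.obj (op b) → S)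
    (h : ∀ {a a' b b' : K} (f : c ⟶ a ⊗ b) (s : a ⟶ a') (t : b ⟶ b') (x : P.obj (op a'))
      (y : R.obj (op b')), φ (f ≫ (s ⊗ₘ t)) x y = φ f (P.map s.op x) (R.map t.op y))
    (q : DayObj P R c) : S :=
  Quot.lift (fun g => φ g.arrow g.x g.y) (fun _ _ r => by
    cases r with
    | glide f s t x y => exact h f s t x y) q

/-- The Day convolution of two presheaves of sets. -/
def day (P R : Kᵒᵖ ⥤ Type u) : Kᵒᵖ ⥤ Type u where
  obj c := DayObj P R c.unop
  map g := ↾(DayObj.lift (fun f x y => DayObj.mk (g.unop ≫ f) x y) (fun f s t x y => by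
    rw [← Category.assoc]
    exact DayObj.glide (g.unop ≫ f) s t x y))
  map_id c := by
    ext q
    induction q using DayObj.ind with
    | h f x y => exact congrArg (fun k => DayObj.mk k x y) (Category.id_comp f)
  map_comp g g' := by
    ext q
    induction q using DayObj.ind with
    | h f x y => exact congrArg (fun k => DayObj.mk k x y) (Category.assoc g'.unop g.unop f)

/-- Natural transformations out of a Day convolution. -/
def day.desc {P R Z : Kᵒᵖ ⥤ Type u}
    (φ : ∀ {c a b : K}, (c ⟶ a ⊗ b) → P.obj (op a) → R.obj (op b) → Z.obj (op c))
    (h : ∀ {c a a' b b' : K} (f : c ⟶ a ⊗ b) (s : a ⟶ a') (t : b ⟶ b') (x : P.obj (op a'))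
      (y : R.obj (op b')), φ (f ≫ (s ⊗ₘ t)) x y = φ f (P.map s.op x) (R.map t.op y))
    (h' : ∀ {c c' a b : K} (g : c' ⟶ c) (f : c ⟶ a ⊗ b) (x : P.obj (op a)) (y : R.obj (op b)),
      φ (g ≫ f) x y = Z.map g.op (φ f x y)) : day P R ⟶ Z where
  app c := ↾(DayObj.lift (fun f x y => φ f x y) (fun f s t x y => h f s t x y))
  naturality c c' g := by
    ext q
    induction q using DayObj.ind with
    | h f x y => exact h' g.unop f x y

/-- Functoriality of the Day convolution. -/
def day.map {P P' R R' : Kᵒᵖ ⥤ Type u} (m : P ⟶ P') (n : R ⟶ R') : day P R ⟶ day P' R' :=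
  day.desc (Z := day P' R') (fun f x y => DayObj.mk f (m.app _ x) (n.app _ y))
    (fun f s t x y => by
      rw [DayObj.glide, NatTrans.naturality_apply, NatTrans.naturality_apply])
    (fun _ _ _ _ => rfl)

theorem DayObj.glide_right {P R S : Kᵒᵖ ⥤ Type u} {c a a' d d' b b' : K} (f : c ⟶ a ⊗ (d ⊗ b))
    (s : a ⟶ a') (t : d ⟶ d') (r : b ⟶ b') (x : P.obj (op a')) (y : R.obj (op d'))
    (z : S.obj (op b')) :
    DayObj.mk (P := P) (R := day R S) (f ≫ (s ⊗ₘ (t ⊗ₘ r))) x (DayObj.mk (𝟙 _) y z) =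
      DayObj.mk (P := P) (R := day R S) f (P.map s.op x)
        (DayObj.mk (𝟙 _) (R.map t.op y) (S.map r.op z)) := by
  refine (DayObj.glide f s (t ⊗ₘ r) x _).trans ?_
  refine congrArg (fun w => DayObj.mk (P := P) (R := day R S) f (P.map s.op x) w) ?_
  refine Eq.trans ?_ (DayObj.glide (𝟙 _) t r y z)
  exact congrArg (fun k => DayObj.mk k y z) ((Category.comp_id _).trans (Category.id_comp _).symm)

/-- The associator of the Day convolution. -/
def day.assoc (P R S : Kᵒᵖ ⥤ Type u) : day (day P R) S ⟶ day P (day R S) :=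
  day.desc (Z := day P (day R S))
    (fun {c e b} f q z => DayObj.lift (S := DayObj P (day R S) c)
      (fun {a a'} g x y => DayObj.mk (f ≫ (g ▷ b) ≫ (α_ a a' b).hom) x
        (DayObj.mk (𝟙 (a' ⊗ b)) y z))
      (fun {a a' d d'} g s t x y => by
        have e : f ≫ (g ≫ (s ⊗ₘ t)) ▷ b ≫ (α_ a' d' b).hom =
            (f ≫ g ▷ b ≫ (α_ a d b).hom) ≫ (s ⊗ₘ (t ⊗ₘ 𝟙 b)) := by
          rw [Category.assoc, Category.assoc, ← associator_naturality, ← tensorHom_id g,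
            tensorHom_comp_tensorHom_assoc, Category.comp_id, tensorHom_id]
        rw [e, DayObj.glide_right]
        simp) q)
    (fun {c e e' b b'} f s t q z => by
      induction q using DayObj.ind with
      | h g x y =>
        rename_i a d
        change DayObj.mk (P := P) (R := day R S)
            ((f ≫ (s ⊗ₘ t)) ≫ g ▷ b' ≫ (α_ a d b').hom) x (DayObj.mk (𝟙 _) y z) =
          DayObj.mk (P := P) (R := day R S) (f ≫ (s ≫ g) ▷ b ≫ (α_ a d b).hom) x
            (DayObj.mk (𝟙 _) y (S.map t.op z))
        have e : (f ≫ (s ⊗ₘ t)) ≫ g ▷ b' ≫ (α_ a d b').hom =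
            (f ≫ (s ≫ g) ▷ b ≫ (α_ a d b).hom) ≫ (𝟙 a ⊗ₘ (𝟙 d ⊗ₘ t)) := by
          simp [MonoidalCategory.tensorHom_def, whisker_exchange_assoc]
        rw [e, DayObj.glide_right]
        simp)
    (fun {c c' e b} k f q z => by
      induction q using DayObj.ind with
      | h g x y =>
        exact congrArg (fun k => DayObj.mk (P := P) (R := day R S) k x (DayObj.mk (𝟙 _) y z))
          (Category.assoc k f _))

/-- The left unitor of the Day convolution; the unit is the presheaf represented by `I`. -/
def day.leftUnitor (P : Kᵒᵖ ⥤ Type u) : day (yoneda.obj (𝟙_ K)) P ⟶ P :=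
  day.desc (fun {c a b} f i y => P.map (f ≫ ((show a ⟶ 𝟙_ K from i) ▷ b) ≫ (λ_ b).hom).op y)
    (fun {c a a' b b'} f s t i y => by
      have e : (f ≫ (s ⊗ₘ t)) ≫ (show a' ⟶ 𝟙_ K from i) ▷ b' ≫ (λ_ b').hom =
          (f ≫ (s ≫ (show a' ⟶ 𝟙_ K from i)) ▷ b ≫ (λ_ b).hom) ≫ t := by
        simp [MonoidalCategory.tensorHom_def, whisker_exchange_assoc]
      rw [e, op_comp, Functor.map_comp]
      rfl)
    (fun k f i y => by
      rw [Category.assoc, op_comp, Functor.map_comp]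
      rfl)

/-- The right unitor of the Day convolution. -/
def day.rightUnitor (P : Kᵒᵖ ⥤ Type u) : day P (yoneda.obj (𝟙_ K)) ⟶ P :=
  day.desc (fun {c a b} f x i => P.map (f ≫ (a ◁ (show b ⟶ 𝟙_ K from i)) ≫ (ρ_ a).hom).op x)
    (fun {c a a' b b'} f s t x i => by
      have e : (f ≫ (s ⊗ₘ t)) ≫ a' ◁ (show b' ⟶ 𝟙_ K from i) ≫ (ρ_ a').hom =
          (f ≫ a ◁ (t ≫ (show b' ⟶ 𝟙_ K from i)) ≫ (ρ_ a).hom) ≫ s := by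
        simp [tensorHom_def', ← whisker_exchange_assoc]
      rw [e, op_comp, Functor.map_comp]
      rfl)
    (fun k f x i => by
      rw [Category.assoc, op_comp, Functor.map_comp]
      rfl)

/-- The braiding of the Day convolution. -/
def day.braiding [BraidedCategory K] (P R : Kᵒᵖ ⥤ Type u) : day P R ⟶ day R P :=
  day.desc (Z := day R P) (fun {c a b} f x y => DayObj.mk (f ≫ (β_ a b).hom) y x)
    (fun f s t x y => by
      rw [Category.assoc, BraidedCategory.braiding_naturality, ← Category.assoc, DayObj.glide])
    (fun g f x y => congrArg (fun k => DayObj.mk k y x) (Category.assoc g f _))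

end DayConvolution

section Reflection

variable (Q : Type u) [Category.{u} Q]

/-- The presheaves `Qᵒᵖ ⥤ Set` that preserve binary products, that is, send every binary coproduct
that exists in `Q` to a product of sets. -/
abbrev prodPreserving : ObjectProperty (Qᵒᵖ ⥤ Type u) :=
  ObjectProperty.preservesLimitsOfShape (Discrete WalkingPair)

instance : (prodPreserving Q).ι.IsRightAdjoint := by
  have : Fact (Cardinal.aleph0.{u}).IsRegular := ⟨Cardinal.isRegular_aleph0⟩
  have hy : ∀ X : Q, IsCardinalPresentable (shrinkYoneda.{u}.obj X) Cardinal.aleph0.{u} := fun X =>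
    isCardinalPresentable_of_iso
      (uliftYonedaIsoYoneda.{u}.app X ≪≫ (shrinkYonedaIsoYoneda.app X).symm) _
  rw [prodPreserving, Presheaf.preservesLimitsOfShape_eq_isLocal]
  refine MorphismProperty.isRightAdjoint_ι_isLocal _ Cardinal.aleph0.{u} ?_
  intro X Y f hf
  simp only [MorphismProperty.iSup_iff] at hf
  obtain ⟨F, ⟨h⟩⟩ := hf
  refine ⟨?_, hy _⟩
  have : ∀ k, IsCardinalPresentable ((F.leftOp ⋙ shrinkYoneda.{u}).obj k) Cardinal.aleph0.{u} :=
    fun k => hy _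
  refine isCardinalPresentable_of_isColimit _ (colimit.isColimit (F.leftOp ⋙ shrinkYoneda.{u}))
    Cardinal.aleph0.{u} ?_
  rw [hasCardinalLT_aleph0_iff]
  infer_instance

variable {Q}

/-- `L : Set^{Qᵒᵖ} → [Set^{Qᵒᵖ}]_prod`, the left adjoint of the inclusion. -/
noncomputable def reflector : (Qᵒᵖ ⥤ Type u) ⥤ (prodPreserving Q).FullSubcategory :=
  (prodPreserving Q).ι.leftAdjoint

/-- The adjunction of `L` and the inclusion. -/
noncomputable def reflectorAdj : reflector (Q := Q) ⊣ (prodPreserving Q).ι :=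
  Adjunction.ofIsRightAdjoint _

/-- `i L : Set^{Qᵒᵖ} → Set^{Qᵒᵖ}`. -/
noncomputable abbrev refl₀ : (Qᵒᵖ ⥤ Type u) ⥤ (Qᵒᵖ ⥤ Type u) := reflector ⋙ (prodPreserving Q).ι

/-- The unit `P → i L P`. -/
noncomputable abbrev reflUnit₀ (P : Qᵒᵖ ⥤ Type u) : P ⟶ refl₀.obj P := reflectorAdj.unit.app P

/-- The extension `i L P → Z` of `P → Z` along the unit, for product preserving `Z`. -/
noncomputable def reflLift₀ {P Z : Qᵒᵖ ⥤ Type u} (hZ : prodPreserving Q Z) (g : P ⟶ Z) :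
    refl₀.obj P ⟶ Z :=
  (prodPreserving Q).ι.map ((reflectorAdj.homEquiv P ⟨Z, hZ⟩).symm g)

theorem reflLift₀_fac {P Z : Qᵒᵖ ⥤ Type u} (hZ : prodPreserving Q Z) (g : P ⟶ Z) :
    reflUnit₀ P ≫ reflLift₀ hZ g = g := by
  have h := (reflectorAdj (Q := Q)).homEquiv_unit (X := P) (Y := ⟨Z, hZ⟩)
    (f := (reflectorAdj.homEquiv P ⟨Z, hZ⟩).symm g)
  rw [Equiv.apply_symm_apply] at h
  exact h.symm

variable [MonoidalCategory Q]

/-- The presheaves `c ↦ Z(c ⊗ -)`, functorially in `c`. -/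
def shiftPsh (Z : Qᵒᵖ ⥤ Type u) : Qᵒᵖ ⥤ (Qᵒᵖ ⥤ Type u) where
  obj c := (tensorLeft c.unop).op ⋙ Z
  map f := { app := fun b => Z.map (f.unop ▷ b.unop).op
             naturality := fun b b' g => by
              change Z.map _ ≫ Z.map _ = Z.map _ ≫ Z.map _
              rw [← Z.map_comp, ← Z.map_comp]
              congr 1
              exact congrArg Quiver.Hom.op (whisker_exchange f.unop g.unop).symm }
  map_id c := by ext b x; simp
  map_comp f g := by ext b x; simp

/-- The internal hom of the Day convolution: `(S ⊸ Z)(c) = Nat(S, Z(c ⊗ -))`. -/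
def dayHom (S Z : Qᵒᵖ ⥤ Type u) : Qᵒᵖ ⥤ Type u := shiftPsh Z ⋙ coyoneda.obj (op S)

theorem dayHom_prodPreserving
    [∀ X : Q, PreservesColimitsOfShape (Discrete WalkingPair) (tensorRight X)]
    (S : Qᵒᵖ ⥤ Type u) {Z : Qᵒᵖ ⥤ Type u} (hZ : prodPreserving Q Z) :
    prodPreserving Q (dayHom S Z) := by
  have : PreservesLimitsOfShape (Discrete WalkingPair) Z := hZ
  have : PreservesLimitsOfShape (Discrete WalkingPair) (shiftPsh Z) := by
    refine preservesLimitsOfShape_of_evaluation _ _ (fun b => ?_)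
    have : PreservesColimitsOfShape (Discrete WalkingPair)ᵒᵖ (tensorRight b.unop) :=
      preservesColimitsOfShape_of_equiv (Discrete.opposite WalkingPair).symm _
    have : PreservesLimitsOfShape (Discrete WalkingPair) (tensorRight b.unop).op :=
      preservesLimitsOfShape_op _ _
    exact inferInstanceAs
      (PreservesLimitsOfShape (Discrete WalkingPair) ((tensorRight b.unop).op ⋙ Z))
  exact inferInstanceAs
    (PreservesLimitsOfShape (Discrete WalkingPair) (shiftPsh Z ⋙ coyoneda.obj (op S)))

/-- Currying. -/
def dayCurry {P S Z : Qᵒᵖ ⥤ Type u} (g : day P S ⟶ Z) : P ⟶ dayHom S Z where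
  app c := ↾(fun x =>
    { app := fun b => ↾(fun y => g.app (op (c.unop ⊗ b.unop)) (DayObj.mk (𝟙 _) x y))
      naturality := fun b b' h => by
        ext y
        refine Eq.trans ?_ (NatTrans.naturality_apply g ((c.unop ◁ h.unop).op) _)
        refine congrArg (fun w => g.app (op (c.unop ⊗ b'.unop)) w) ?_
        have e := DayObj.glide (P := P) (R := S) (𝟙 (c.unop ⊗ b'.unop)) (𝟙 c.unop) h.unop x y
        rw [op_id, Functor.map_id_apply] at e
        refine e.symm.trans ?_
        refine congrArg (fun k => DayObj.mk (P := P) (R := S) k x y) ?_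
        exact (Category.id_comp _).trans ((id_tensorHom _ _).trans (Category.comp_id _).symm) })
  naturality c c' h := by
    ext x
    refine NatTrans.ext (funext fun b => ?_)
    ext y
    refine Eq.trans ?_ (NatTrans.naturality_apply g ((h.unop ▷ b.unop).op) _)
    refine congrArg (fun w => g.app (op (c'.unop ⊗ b.unop)) w) ?_
    have e := DayObj.glide (P := P) (R := S) (𝟙 (c'.unop ⊗ b.unop)) h.unop (𝟙 b.unop) x y
    rw [op_id, Functor.map_id_apply] at e
    refine e.symm.trans ?_
    refine congrArg (fun k => DayObj.mk (P := P) (R := S) k x y) ?_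
    exact (Category.id_comp _).trans ((tensorHom_id _ _).trans (Category.comp_id _).symm)

/-- Evaluation of a curried natural transformation. -/
def dayEval {P S Z : Qᵒᵖ ⥤ Type u} (n : P ⟶ dayHom S Z) {a b : Q} (x : P.obj (op a))
    (y : S.obj (op b)) : Z.obj (op (a ⊗ b)) :=
  (show S ⟶ (tensorLeft a).op ⋙ Z from n.app (op a) x).app (op b) y

theorem dayEval_map {P S Z : Qᵒᵖ ⥤ Type u} (n : P ⟶ dayHom S Z) {a a' b b' : Q} (s : a ⟶ a')
    (t : b ⟶ b') (x : P.obj (op a')) (y : S.obj (op b')) :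
    dayEval n (P.map s.op x) (S.map t.op y) = Z.map (s ⊗ₘ t).op (dayEval n x y) := by
  have e₁ : n.app (op a) (P.map s.op x) = (dayHom S Z).map s.op (n.app (op a') x) :=
    NatTrans.naturality_apply n s.op x
  have e₂ : dayEval n x (S.map t.op y) = Z.map (a' ◁ t).op (dayEval n x y) :=
    NatTrans.naturality_apply (show S ⟶ (tensorLeft a').op ⋙ Z from n.app (op a') x) t.op y
  have e₃ : dayEval n (P.map s.op x) (S.map t.op y) =
      Z.map (s ▷ b).op (dayEval n x (S.map t.op y)) :=
    congrArg (fun m : S ⟶ (tensorLeft a).op ⋙ Z => m.app (op b) (S.map t.op y)) e₁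
  rw [e₃, e₂, MonoidalCategory.tensorHom_def, op_comp, Functor.map_comp_apply]

/-- Uncurrying. -/
def dayUncurry {P S Z : Qᵒᵖ ⥤ Type u} (n : P ⟶ dayHom S Z) : day P S ⟶ Z :=
  day.desc (fun f x y => Z.map f.op (dayEval n x y))
    (fun f s t x y => by rw [dayEval_map, op_comp, Functor.map_comp_apply])
    (fun k f x y => by rw [op_comp, Functor.map_comp_apply])

/-- A natural transformation `P ⊗ S → Z` into a product preserving `Z` extends uniquely along
`P ⊗ S → i L P ⊗ S`. -/
noncomputable def dayExtend [∀ X : Q, PreservesColimitsOfShape (Discrete WalkingPair) (tensorRight X)]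
    {P S Z : Qᵒᵖ ⥤ Type u} (hZ : prodPreserving Q Z) (g : day P S ⟶ Z) :
    day (refl₀.obj P) S ⟶ Z :=
  dayUncurry (reflLift₀ (dayHom_prodPreserving S hZ) (dayCurry g))

theorem dayExtend_fac [∀ X : Q, PreservesColimitsOfShape (Discrete WalkingPair) (tensorRight X)]
    {P S Z : Qᵒᵖ ⥤ Type u} (hZ : prodPreserving Q Z) (g : day P S ⟶ Z) :
    day.map (reflUnit₀ P) (𝟙 S) ≫ dayExtend hZ g = g := by
  ext c q
  induction q using DayObj.ind with
  | h f x y =>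
    rename_i a b
    have e : (reflLift₀ (dayHom_prodPreserving S hZ) (dayCurry g)).app (op a)
        ((reflUnit₀ P).app (op a) x) = (dayCurry g).app (op a) x :=
      ConcreteCategory.congr_hom (NatTrans.congr_app
        (reflLift₀_fac (dayHom_prodPreserving S hZ) (dayCurry g)) (op a)) x
    have e' : dayEval (reflLift₀ (dayHom_prodPreserving S hZ) (dayCurry g))
        ((reflUnit₀ P).app (op a) x) y = dayEval (dayCurry g) x y :=
      congrArg (fun m : S ⟶ (tensorLeft a).op ⋙ Z => m.app (op b) y) e
    refine (congrArg (fun w => Z.map f.op w) e').trans ?_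
    refine (NatTrans.naturality_apply g f.op _).symm.trans ?_
    exact congrArg (fun k => g.app c (DayObj.mk k x y)) (Category.comp_id f)

end Reflection

section FunctorCategories

variable {A : Type u₁} [EnrichedCategory Biset.{u} A] {B : Type u₂} [EnrichedCategory Biset.{u} B]
  {D : Type u₃} [EnrichedCategory Biset.{u} D]

/-- `X →₀ Y`. -/
abbrev Hom₀ (X Y : A) : Type u := (X ⟶[Biset.{u}] Y).zero

/-- `X →₁ Y`. -/
abbrev Hom₁ (X Y : A) : Type u := (X ⟶[Biset.{u}] Y).one

/-- The structure map `φ` from `X →₁ Y` to `X →₀ Y`. -/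
abbrev Hom₁.φ {X Y : A} (f : Hom₁ X Y) : Hom₀ X Y := (X ⟶[Biset.{u}] Y).map f

/-- Composition in `A₀` (diagrammatic order). -/
def comp₀ {X Y Z : A} (f : Hom₀ X Y) (g : Hom₀ Y Z) : Hom₀ X Z :=
  Biset.Hom.zero (eComp Biset.{u} X Y Z) (f, g)

/-- Composition in `A₁` (diagrammatic order). -/
def comp₁ {X Y Z : A} (f : Hom₁ X Y) (g : Hom₁ Y Z) : Hom₁ X Z :=
  Biset.Hom.one (eComp Biset.{u} X Y Z) (f, g)

/-- The identity in `A₁`. -/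
def id₁ (X : A) : Hom₁ X X := Biset.Hom.one (eId Biset.{u} X) PUnit.unit

/-- The identity in `A₀`. -/
def id₀ (X : A) : Hom₀ X X := Biset.Hom.zero (eId Biset.{u} X) PUnit.unit

/-- `F⁰` on morphisms. -/
def map₀ (F : EnrichedFunctor Biset.{u} A B) {X Y : A} (f : Hom₀ X Y) :
    Hom₀ (F.obj X) (F.obj Y) := Biset.Hom.zero (F.map X Y) f

/-- `F¹` on morphisms. -/
def map₁ (F : EnrichedFunctor Biset.{u} A B) {X Y : A} (f : Hom₁ X Y) :
    Hom₁ (F.obj X) (F.obj Y) := Biset.Hom.one (F.map X Y) f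

theorem φ_comp {X Y Z : A} (f : Hom₁ X Y) (g : Hom₁ Y Z) :
    (comp₁ f g).φ = comp₀ f.φ g.φ := Biset.Hom.comm (eComp Biset.{u} X Y Z) (f, g)

theorem φ_id (X : A) : (id₁ X).φ = id₀ X := Biset.Hom.comm (eId Biset.{u} X) PUnit.unit

theorem φ_map (F : EnrichedFunctor Biset.{u} A B) {X Y : A} (f : Hom₁ X Y) :
    (map₁ F f).φ = map₀ F f.φ := Biset.Hom.comm (F.map X Y) f

theorem id_comp₀ {X Y : A} (f : Hom₀ X Y) : comp₀ (id₀ X) f = f :=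
  congrFun (congrArg Biset.Hom.zero (e_id_comp Biset.{u} X Y)) f

theorem comp_id₀ {X Y : A} (f : Hom₀ X Y) : comp₀ f (id₀ Y) = f :=
  congrFun (congrArg Biset.Hom.zero (e_comp_id Biset.{u} X Y)) f

theorem assoc₀ {W X Y Z : A} (f : Hom₀ W X) (g : Hom₀ X Y) (h : Hom₀ Y Z) :
    comp₀ (comp₀ f g) h = comp₀ f (comp₀ g h) :=
  congrFun (congrArg Biset.Hom.zero (e_assoc Biset.{u} W X Y Z)) (f, (g, h))

theorem id_comp₁ {X Y : A} (f : Hom₁ X Y) : comp₁ (id₁ X) f = f :=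
  congrFun (congrArg Biset.Hom.one (e_id_comp Biset.{u} X Y)) f

theorem comp_id₁ {X Y : A} (f : Hom₁ X Y) : comp₁ f (id₁ Y) = f :=
  congrFun (congrArg Biset.Hom.one (e_comp_id Biset.{u} X Y)) f

theorem assoc₁ {W X Y Z : A} (f : Hom₁ W X) (g : Hom₁ X Y) (h : Hom₁ Y Z) :
    comp₁ (comp₁ f g) h = comp₁ f (comp₁ g h) :=
  congrFun (congrArg Biset.Hom.one (e_assoc Biset.{u} W X Y Z)) (f, (g, h))

theorem map_comp₀ (F : EnrichedFunctor Biset.{u} A B) {X Y Z : A} (f : Hom₀ X Y) (g : Hom₀ Y Z) :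
    map₀ F (comp₀ f g) = comp₀ (map₀ F f) (map₀ F g) :=
  congrFun (congrArg Biset.Hom.zero (F.map_comp X Y Z)) (f, g)

theorem map_comp₁ (F : EnrichedFunctor Biset.{u} A B) {X Y Z : A} (f : Hom₁ X Y) (g : Hom₁ Y Z) :
    map₁ F (comp₁ f g) = comp₁ (map₁ F f) (map₁ F g) :=
  congrFun (congrArg Biset.Hom.one (F.map_comp X Y Z)) (f, g)

theorem map_id₀ (F : EnrichedFunctor Biset.{u} A B) (X : A) : map₀ F (id₀ X) = id₀ (F.obj X) :=
  congrFun (congrArg Biset.Hom.zero (F.map_id X)) PUnit.unit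

theorem map_id₁ (F : EnrichedFunctor Biset.{u} A B) (X : A) : map₁ F (id₁ X) = id₁ (F.obj X) :=
  congrFun (congrArg Biset.Hom.one (F.map_id X)) PUnit.unit

end FunctorCategories

section FunctorCategories

variable {A : Type u} [EnrichedCategory Biset.{u} A] {B : Type u₂} [EnrichedCategory Biset.{u} B]
  {D : Type u₃} [EnrichedCategory Biset.{u} D]

/-- `F ⇒₀ G`: families `F X →₀ G X` that are natural with respect to all `X →₀ Y`. -/
@[ext]
structure Nat₀ (F G : EnrichedFunctor Biset.{u} A B) : Type u where
  app (X : A) : Hom₀ (F.obj X) (G.obj X)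
  natural {X Y : A} (g : Hom₀ X Y) : comp₀ (map₀ F g) (app Y) = comp₀ (app X) (map₀ G g)

/-- `F ⇒₁ G`: families `F X →₁ G X` that are natural with respect to all `X →₁ Y` and whose
images under `φ` are natural with respect to all `X →₀ Y`. -/
@[ext]
structure Nat₁ (F G : EnrichedFunctor Biset.{u} A B) : Type u where
  app (X : A) : Hom₁ (F.obj X) (G.obj X)
  natural₁ {X Y : A} (f : Hom₁ X Y) : comp₁ (map₁ F f) (app Y) = comp₁ (app X) (map₁ G f)
  natural₀ {X Y : A} (g : Hom₀ X Y) : comp₀ (map₀ F g) (app Y).φ = comp₀ (app X).φ (map₀ G g)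

/-- The map `F ⇒₁ G → F ⇒₀ G`. -/
def Nat₁.toNat₀ {F G : EnrichedFunctor Biset.{u} A B} (α : Nat₁ F G) : Nat₀ F G :=
  ⟨fun X => (α.app X).φ, α.natural₀⟩

/-- The functor `Biset`-category `B^A`. -/
instance functorEnriched : EnrichedCategory Biset.{u} (EnrichedFunctor Biset.{u} A B) where
  Hom F G := ⟨Nat₀ F G, Nat₁ F G, Nat₁.toNat₀⟩
  id F :=
    ⟨fun _ => ⟨fun X => id₀ (F.obj X), fun g => by rw [comp_id₀, id_comp₀]⟩,
      fun _ => ⟨fun X => id₁ (F.obj X), fun f => by rw [comp_id₁, id_comp₁],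
        fun g => by rw [φ_id, φ_id, comp_id₀, id_comp₀]⟩,
      fun _ => Nat₀.ext (funext fun X => φ_id (F.obj X))⟩
  comp F G H :=
    ⟨fun p => ⟨fun X => comp₀ (p.1.app X) (p.2.app X), fun g => by
        rw [← assoc₀, p.1.natural, assoc₀, p.2.natural, assoc₀]⟩,
      fun p => ⟨fun X => comp₁ (p.1.app X) (p.2.app X), fun f => by
        rw [← assoc₁, p.1.natural₁, assoc₁, p.2.natural₁, assoc₁], fun g => by
        rw [φ_comp, φ_comp, ← assoc₀, p.1.natural₀, assoc₀, p.2.natural₀, assoc₀]⟩,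
      fun p => Nat₀.ext (funext fun X => φ_comp _ _)⟩
  id_comp F G := Biset.hom_ext (fun β => Nat₀.ext (funext fun X => id_comp₀ (β.app X)))
    (fun α => Nat₁.ext (funext fun X => id_comp₁ (α.app X)))
  comp_id F G := Biset.hom_ext (fun β => Nat₀.ext (funext fun X => comp_id₀ (β.app X)))
    (fun α => Nat₁.ext (funext fun X => comp_id₁ (α.app X)))
  assoc F G H K :=
    Biset.hom_ext
      (fun p => Nat₀.ext (funext fun X => assoc₀ (p.1.app X) (p.2.1.app X) (p.2.2.app X)))
      (fun p => Nat₁.ext (funext fun X => assoc₁ (p.1.app X) (p.2.1.app X) (p.2.2.app X)))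

/-- Postcomposition with a `Biset`-functor `H : B → D`, as a `Biset`-functor `B^A → D^A`. -/
def postcompose (H : EnrichedFunctor Biset.{u} B D) :
    EnrichedFunctor Biset.{u} (EnrichedFunctor Biset.{u} A B) (EnrichedFunctor Biset.{u} A D) where
  obj F := F.comp Biset.{u} H
  map F G :=
    ⟨fun β => ⟨fun X => map₀ H (β.app X), fun {X Y} g => by
        refine (map_comp₀ H (map₀ F g) (β.app Y)).symm.trans ?_
        rw [β.natural, map_comp₀]
        rfl⟩,
      fun α => ⟨fun X => map₁ H (α.app X), fun {X Y} f => by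
        refine (map_comp₁ H (map₁ F f) (α.app Y)).symm.trans ?_
        rw [α.natural₁, map_comp₁]
        rfl, fun {X Y} g => by
        change comp₀ (map₀ H (map₀ F g)) (map₁ H (α.app Y)).φ =
          comp₀ (map₁ H (α.app X)).φ (map₀ H (map₀ G g))
        rw [φ_map, φ_map]
        refine (map_comp₀ H (map₀ F g) (α.app Y).φ).symm.trans ?_
        rw [α.natural₀, map_comp₀]⟩,
      fun α => Nat₀.ext (funext fun X => φ_map H (α.app X))⟩
  map_id F := Biset.hom_ext (fun _ => Nat₀.ext (funext fun X => map_id₀ H (F.obj X)))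
    (fun _ => Nat₁.ext (funext fun X => map_id₁ H (F.obj X)))
  map_comp F G K :=
    Biset.hom_ext (fun p => Nat₀.ext (funext fun X => map_comp₀ H (p.1.app X) (p.2.app X)))
      (fun p => Nat₁.ext (funext fun X => map_comp₁ H (p.1.app X) (p.2.app X)))

end FunctorCategories

/-- A symmetric monoidal category `M` with the same objects, tensor product of objects and tensor
unit as `Q`, together with a strict symmetric monoidal functor `J : M → Q` that is the identity on
objects. -/
structure Interpretation (Q : Type u) [Category.{u} Q] [MonoidalCategory Q]
    [SymmetricCategory Q] where
  Hom : Q → Q → Type u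
  id (X : Q) : Hom X X
  comp {X Y Z : Q} : Hom X Y → Hom Y Z → Hom X Z
  id_comp {X Y : Q} (f : Hom X Y) : comp (id X) f = f
  comp_id {X Y : Q} (f : Hom X Y) : comp f (id Y) = f
  assoc {W X Y Z : Q} (f : Hom W X) (g : Hom X Y) (h : Hom Y Z) :
    comp (comp f g) h = comp f (comp g h)
  tensor {X₁ Y₁ X₂ Y₂ : Q} : Hom X₁ Y₁ → Hom X₂ Y₂ → Hom (X₁ ⊗ X₂) (Y₁ ⊗ Y₂)
  tensor_id (X Y : Q) : tensor (id X) (id Y) = id (X ⊗ Y)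
  tensor_comp {X₁ Y₁ Z₁ X₂ Y₂ Z₂ : Q} (f₁ : Hom X₁ Y₁) (f₂ : Hom X₂ Y₂)
    (g₁ : Hom Y₁ Z₁) (g₂ : Hom Y₂ Z₂) :
    comp (tensor f₁ f₂) (tensor g₁ g₂) = tensor (comp f₁ g₁) (comp f₂ g₂)
  assocHom (X Y Z : Q) : Hom ((X ⊗ Y) ⊗ Z) (X ⊗ (Y ⊗ Z))
  assocInv (X Y Z : Q) : Hom (X ⊗ (Y ⊗ Z)) ((X ⊗ Y) ⊗ Z)
  assoc_hom_inv (X Y Z : Q) : comp (assocHom X Y Z) (assocInv X Y Z) = id _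
  assoc_inv_hom (X Y Z : Q) : comp (assocInv X Y Z) (assocHom X Y Z) = id _
  leftHom (X : Q) : Hom (𝟙_ Q ⊗ X) X
  leftInv (X : Q) : Hom X (𝟙_ Q ⊗ X)
  left_hom_inv (X : Q) : comp (leftHom X) (leftInv X) = id _
  left_inv_hom (X : Q) : comp (leftInv X) (leftHom X) = id _
  rightHom (X : Q) : Hom (X ⊗ 𝟙_ Q) X
  rightInv (X : Q) : Hom X (X ⊗ 𝟙_ Q)
  right_hom_inv (X : Q) : comp (rightHom X) (rightInv X) = id _
  right_inv_hom (X : Q) : comp (rightInv X) (rightHom X) = id _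
  braid (X Y : Q) : Hom (X ⊗ Y) (Y ⊗ X)
  braid_braid (X Y : Q) : comp (braid X Y) (braid Y X) = id _
  assoc_natural {X₁ Y₁ X₂ Y₂ X₃ Y₃ : Q} (f₁ : Hom X₁ Y₁) (f₂ : Hom X₂ Y₂) (f₃ : Hom X₃ Y₃) :
    comp (tensor (tensor f₁ f₂) f₃) (assocHom Y₁ Y₂ Y₃) =
      comp (assocHom X₁ X₂ X₃) (tensor f₁ (tensor f₂ f₃))
  left_natural {X Y : Q} (f : Hom X Y) :
    comp (tensor (id (𝟙_ Q)) f) (leftHom Y) = comp (leftHom X) f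
  right_natural {X Y : Q} (f : Hom X Y) :
    comp (tensor f (id (𝟙_ Q))) (rightHom Y) = comp (rightHom X) f
  braid_natural {X₁ Y₁ X₂ Y₂ : Q} (f₁ : Hom X₁ Y₁) (f₂ : Hom X₂ Y₂) :
    comp (tensor f₁ f₂) (braid Y₁ Y₂) = comp (braid X₁ X₂) (tensor f₂ f₁)
  pentagon (W X Y Z : Q) :
    comp (tensor (assocHom W X Y) (id Z))
        (comp (assocHom W (X ⊗ Y) Z) (tensor (id W) (assocHom X Y Z))) =
      comp (assocHom (W ⊗ X) Y Z) (assocHom W X (Y ⊗ Z))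
  triangle (X Y : Q) :
    comp (assocHom X (𝟙_ Q) Y) (tensor (id X) (leftHom Y)) = tensor (rightHom X) (id Y)
  hexagon (X Y Z : Q) :
    comp (assocHom X Y Z) (comp (braid X (Y ⊗ Z)) (assocHom Y Z X)) =
      comp (tensor (braid X Y) (id Z)) (comp (assocHom Y X Z) (tensor (id Y) (braid X Z)))
  J {X Y : Q} : Hom X Y → (X ⟶ Y)
  J_id (X : Q) : J (id X) = 𝟙 X
  J_comp {X Y Z : Q} (f : Hom X Y) (g : Hom Y Z) : J (comp f g) = J f ≫ J g
  J_tensor {X₁ Y₁ X₂ Y₂ : Q} (f : Hom X₁ Y₁) (g : Hom X₂ Y₂) : J (tensor f g) = J f ⊗ₘ J g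
  J_assoc (X Y Z : Q) : J (assocHom X Y Z) = (α_ X Y Z).hom
  J_left (X : Q) : J (leftHom X) = (λ_ X).hom
  J_right (X : Q) : J (rightHom X) = (ρ_ X).hom
  J_braid (X Y : Q) : J (braid X Y) = (β_ X Y).hom

section Model

variable {Q : Type u} [Category.{u} Q] [MonoidalCategory Q] [SymmetricCategory Q]

/-- The objects of `M` and of `C`: those of `Q`. -/
structure Interpretation.Obj (𝓜 : Interpretation Q) : Type u where
  ob : Q

namespace Interpretation

variable (𝓜 : Interpretation Q)

/-- The category `M`. -/
instance : Category.{u} 𝓜.Obj where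
  Hom X Y := 𝓜.Hom X.ob Y.ob
  id X := 𝓜.id X.ob
  comp f g := 𝓜.comp f g
  id_comp := 𝓜.id_comp
  comp_id := 𝓜.comp_id
  assoc := 𝓜.assoc

instance : MonoidalCategoryStruct 𝓜.Obj where
  tensorObj X Y := ⟨X.ob ⊗ Y.ob⟩
  tensorUnit := ⟨𝟙_ Q⟩
  tensorHom f g := 𝓜.tensor f g
  whiskerLeft X _ _ g := 𝓜.tensor (𝓜.id X.ob) g
  whiskerRight f Y := 𝓜.tensor f (𝓜.id Y.ob)
  associator X Y Z :=
    ⟨𝓜.assocHom X.ob Y.ob Z.ob, 𝓜.assocInv X.ob Y.ob Z.ob, 𝓜.assoc_hom_inv _ _ _,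
      𝓜.assoc_inv_hom _ _ _⟩
  leftUnitor X := ⟨𝓜.leftHom X.ob, 𝓜.leftInv X.ob, 𝓜.left_hom_inv _, 𝓜.left_inv_hom _⟩
  rightUnitor X := ⟨𝓜.rightHom X.ob, 𝓜.rightInv X.ob, 𝓜.right_hom_inv _, 𝓜.right_inv_hom _⟩

instance : MonoidalCategory 𝓜.Obj :=
  MonoidalCategory.ofTensorHom
    (id_tensorHom_id := fun X Y => 𝓜.tensor_id X.ob Y.ob)
    (id_tensorHom := fun _ _ _ _ => rfl)
    (tensorHom_id := fun _ _ => rfl)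
    (tensorHom_comp_tensorHom := fun f₁ f₂ g₁ g₂ => 𝓜.tensor_comp f₁ f₂ g₁ g₂)
    (associator_naturality := fun f₁ f₂ f₃ => 𝓜.assoc_natural f₁ f₂ f₃)
    (leftUnitor_naturality := fun f => 𝓜.left_natural f)
    (rightUnitor_naturality := fun f => 𝓜.right_natural f)
    (pentagon := fun W X Y Z => 𝓜.pentagon W.ob X.ob Y.ob Z.ob)
    (triangle := fun X Y => 𝓜.triangle X.ob Y.ob)

/-- The symmetry of `M`. -/
def braidIso (X Y : 𝓜.Obj) : X ⊗ Y ≅ Y ⊗ X where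
  hom := 𝓜.braid X.ob Y.ob
  inv := 𝓜.braid Y.ob X.ob
  hom_inv_id := 𝓜.braid_braid X.ob Y.ob
  inv_hom_id := 𝓜.braid_braid Y.ob X.ob

instance : SymmetricCategory 𝓜.Obj where
  braiding := 𝓜.braidIso
  braiding_naturality_right X _ _ f := 𝓜.braid_natural (𝓜.id X.ob) f
  braiding_naturality_left f Z := 𝓜.braid_natural f (𝓜.id Z.ob)
  hexagon_forward X Y Z := 𝓜.hexagon X.ob Y.ob Z.ob
  hexagon_reverse X Y Z := by
    have h : α_ Z X Y ≪≫ 𝓜.braidIso Z (X ⊗ Y) ≪≫ α_ X Y Z =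
        whiskerRightIso (𝓜.braidIso Z X) Y ≪≫ α_ X Z Y ≪≫ whiskerLeftIso X (𝓜.braidIso Z Y) :=
      Iso.ext (𝓜.hexagon Z.ob X.ob Y.ob)
    have h' := congrArg Iso.inv h
    simp only [Iso.trans_inv, whiskerRightIso_inv, whiskerLeftIso_inv, Category.assoc] at h'
    exact h'
  symmetry X Y := 𝓜.braid_braid X.ob Y.ob

/-- The interpretation functor `J : M ⥤ Q`. -/
def functor : 𝓜.Obj ⥤ Q where
  obj X := X.ob
  map f := 𝓜.J f
  map_id X := 𝓜.J_id X.ob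
  map_comp f g := 𝓜.J_comp f g

/-- The `Biset`-category `C`, with `C(X, Y) = (Q(X, Y), M(X, Y), J)`. -/
instance : EnrichedCategory Biset.{u} 𝓜.Obj where
  Hom X Y := ⟨X.ob ⟶ Y.ob, X ⟶ Y, fun f => 𝓜.functor.map f⟩
  id X := ⟨fun _ => 𝟙 X.ob, fun _ => 𝟙 X, fun _ => 𝓜.functor.map_id X⟩
  comp X Y Z := ⟨fun p => p.1 ≫ p.2, fun p => p.1 ≫ p.2, fun p => 𝓜.functor.map_comp p.1 p.2⟩
  id_comp X Y := Biset.hom_ext (fun f => Category.id_comp f) (fun f => Category.id_comp f)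
  comp_id X Y := Biset.hom_ext (fun f => Category.comp_id f) (fun f => Category.comp_id f)
  assoc W X Y Z := Biset.hom_ext (fun p => Category.assoc p.1 p.2.1 p.2.2)
    (fun p => Category.assoc p.1 p.2.1 p.2.2)

/-- The `Biset`-category `C̄` of `Biset`-functors `Cᵒᵖ → Biset`. -/
abbrev Psh : Type (u + 1) := EnrichedFunctor Biset.{u} 𝓜.Objᵒᵖ Biset.{u}

/-- The `Biset`-category of `Biset`-functors `Cᵒᵖ → Set`. -/
abbrev SetPsh : Type (u + 1) := EnrichedFunctor Biset.{u} 𝓜.Objᵒᵖ (Type u)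

variable {𝓜}

/-- The functor `F⁰ : Qᵒᵖ ⥤ Set`, `X ↦ (F X)₀`, of a `Biset`-functor `F : Cᵒᵖ → Biset`. -/
def Psh.zero (F : 𝓜.Psh) : Qᵒᵖ ⥤ Type u where
  obj X := (F.obj (op ⟨X.unop⟩)).zero
  map {X Y} g := ↾(map₀ F (X := op ⟨X.unop⟩) (Y := op ⟨Y.unop⟩) g.unop)
  map_id X := by
    ext x
    exact congrFun (map_id₀ F (op ⟨X.unop⟩)) x
  map_comp {X Y Z} f g := by
    ext x
    exact congrFun (map_comp₀ F (X := op ⟨X.unop⟩) (Y := op ⟨Y.unop⟩) (Z := op ⟨Z.unop⟩)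
      f.unop g.unop) x

/-- The functor `Mᵒᵖ ⥤ Set`, `X ↦ (F X)₁`, of a `Biset`-functor `F : Cᵒᵖ → Biset`. -/
def Psh.one (F : 𝓜.Psh) : 𝓜.Objᵒᵖ ⥤ Type u where
  obj X := (F.obj X).one
  map {X Y} f := ↾(Biset.Hom.one (map₁ F (X := X) (Y := Y) f.unop))
  map_id X := by
    ext x
    exact congrFun (congrArg Biset.Hom.one (map_id₁ F X)) x
  map_comp {X Y Z} f g := by
    ext x
    exact congrFun (congrArg Biset.Hom.one (map_comp₁ F (X := X) (Y := Y) (Z := Z)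
      f.unop g.unop)) x

/-- The functions `(F X)₁ → (F X)₀`, as a natural transformation. -/
def Psh.str (F : 𝓜.Psh) : F.one ⟶ 𝓜.functor.op ⋙ F.zero where
  app X := ↾(F.obj X).map
  naturality {X Y} f := by
    ext x
    exact (Biset.Hom.comm (map₁ F (X := X) (Y := Y) f.unop) x).trans
      (congrFun (φ_map F (X := X) (Y := Y) f.unop) ((F.obj X).map x))

/-- A `Biset`-functor `Cᵒᵖ → Biset` amounts to functors `Qᵒᵖ ⥤ Set` and `Mᵒᵖ ⥤ Set` and a natural
transformation between them. -/
def Psh.mk (P₀ : Qᵒᵖ ⥤ Type u) (P₁ : 𝓜.Objᵒᵖ ⥤ Type u) (h : P₁ ⟶ 𝓜.functor.op ⋙ P₀) :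
    𝓜.Psh where
  obj X := ⟨P₀.obj (op X.unop.ob), P₁.obj X, fun x => h.app X x⟩
  map X Y := ⟨fun g x => P₀.map (Quiver.Hom.op g) x, fun f =>
    ⟨fun x => P₀.map (𝓜.functor.map f).op x, fun x => P₁.map (Quiver.Hom.op f) x,
      fun x => ConcreteCategory.congr_hom (h.naturality (Quiver.Hom.op f)) x⟩, fun _ => rfl⟩
  map_id X :=
    Biset.hom_ext
      (fun _ => funext fun x => ConcreteCategory.congr_hom (P₀.map_id (op X.unop.ob)) x)
      (fun _ => Biset.hom_ext
        (fun x => (congrArg (fun k => P₀.map (Quiver.Hom.op k) x)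
          (𝓜.functor.map_id X.unop)).trans (ConcreteCategory.congr_hom (P₀.map_id (op X.unop.ob)) x))
        (fun x => ConcreteCategory.congr_hom (P₁.map_id X) x))
  map_comp X Y Z :=
    Biset.hom_ext
      (fun p => funext fun x => ConcreteCategory.congr_hom
        (P₀.map_comp (Quiver.Hom.op p.1) (Quiver.Hom.op p.2)) x)
      (fun p => Biset.hom_ext
        (fun x => (congrArg (fun k => P₀.map (Quiver.Hom.op k) x)
          (𝓜.functor.map_comp p.2 p.1)).trans (ConcreteCategory.congr_hom
            (P₀.map_comp (𝓜.functor.map p.1).op (𝓜.functor.map p.2).op) x))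
        (fun x => ConcreteCategory.congr_hom
          (P₁.map_comp (Quiver.Hom.op p.1) (Quiver.Hom.op p.2)) x))

end Interpretation

namespace Interpretation

variable {𝓜 : Interpretation Q}

/-- Elements of `F ⇒₀ G` are natural transformations `F⁰ → G⁰`. -/
def Psh.nat₀ {F G : 𝓜.Psh} (β : Nat₀ F G) : F.zero ⟶ G.zero where
  app X := ↾(β.app (op ⟨X.unop⟩))
  naturality X Y g := by
    ext x
    exact congrFun (β.natural (X := op ⟨X.unop⟩) (Y := op ⟨Y.unop⟩) g.unop) x

/-- The part of an element of `F ⇒₁ G` at level `1`. -/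
def Psh.nat₁ {F G : 𝓜.Psh} (α : Nat₁ F G) : F.one ⟶ G.one where
  app X := ↾(Biset.Hom.one (α.app X))
  naturality X Y f := by
    ext x
    exact congrFun (congrArg Biset.Hom.one (α.natural₁ (X := X) (Y := Y) f.unop)) x

/-- The converse of `Psh.nat₀`. -/
def Psh.ofNat₀ {F G : 𝓜.Psh} (n : F.zero ⟶ G.zero) : Nat₀ F G where
  app X := fun x => n.app (op X.unop.ob) x
  natural {X Y} g := funext fun x =>
    NatTrans.naturality_apply n (X := op X.unop.ob) (Y := op Y.unop.ob) (Quiver.Hom.op g) x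

/-- Elements of `F ⇒₁ G` amount to pairs of natural transformations, at levels `0` and `1`, that
are compatible with the structure maps of `F` and `G`. -/
def Psh.ofNat₁ {F G : 𝓜.Psh} (n₀ : F.zero ⟶ G.zero) (n₁ : F.one ⟶ G.one)
    (h : n₁ ≫ G.str = F.str ≫ Functor.whiskerLeft 𝓜.functor.op n₀) : Nat₁ F G where
  app X := ⟨fun x => n₀.app (op X.unop.ob) x, fun x => n₁.app X x,
    fun x => ConcreteCategory.congr_hom (NatTrans.congr_app h X) x⟩
  natural₁ {X Y} f := Biset.hom_ext
    (fun x => by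
      have e := NatTrans.naturality_apply n₀ (X := op X.unop.ob) (Y := op Y.unop.ob)
        (𝓜.functor.map f).op x
      have e₁ := congrFun (φ_map F (X := X) (Y := Y) f) x
      have e₂ := congrFun (φ_map G (X := X) (Y := Y) f) (n₀.app (op X.unop.ob) x)
      exact (congrArg (fun w => n₀.app (op Y.unop.ob) w) e₁).trans (e.trans e₂.symm))
    (fun x => NatTrans.naturality_apply n₁ (X := X) (Y := Y) (Quiver.Hom.op f) x)
  natural₀ {X Y} g := funext fun x =>
    NatTrans.naturality_apply n₀ (X := op X.unop.ob) (Y := op Y.unop.ob) (Quiver.Hom.op g) x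

theorem Psh.nat_comm {F G : 𝓜.Psh} (α : Nat₁ F G) :
    Psh.nat₁ α ≫ G.str = F.str ≫ Functor.whiskerLeft 𝓜.functor.op (Psh.nat₀ α.toNat₀) := by
  ext X x
  exact Biset.Hom.comm (α.app X) x

/-- The structure map of the Day convolution. -/
def dayStr (F G : 𝓜.Psh) : day F.one G.one ⟶ 𝓜.functor.op ⋙ day F.zero G.zero :=
  day.desc (Z := 𝓜.functor.op ⋙ day F.zero G.zero)
    (fun {c a b} f x y => DayObj.mk (P := F.zero) (R := G.zero) (c := c.ob) (a := a.ob)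
      (b := b.ob) (𝓜.functor.map f) (F.str.app (op a) x) (G.str.app (op b) y))
    (fun {c a a' b b'} f s t x y => by
      rw [NatTrans.naturality_apply, NatTrans.naturality_apply]
      refine Eq.trans ?_ (DayObj.glide (P := F.zero) (R := G.zero) (c := c.ob) (a := a.ob)
        (b := b.ob) (𝓜.functor.map f) (𝓜.functor.map s) (𝓜.functor.map t) _ _)
      refine congrArg (fun k => DayObj.mk (P := F.zero) (R := G.zero) (c := c.ob) (a := a'.ob)
        (b := b'.ob) k (F.str.app (op a') x) (G.str.app (op b') y)) ?_
      refine (𝓜.functor.map_comp f (s ⊗ₘ t)).trans ?_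
      exact congrArg (fun k => 𝓜.functor.map f ≫ k) (𝓜.J_tensor s t))
    (fun {c c' a b} g f x y => congrArg (fun k => DayObj.mk (P := F.zero) (R := G.zero)
        (c := c'.ob) (a := a.ob) (b := b.ob) k (F.str.app (op a) x) (G.str.app (op b) y))
      (𝓜.functor.map_comp g f))

/-- The Day convolution `(F ⊗ G)(c) = ∫^{a,b} C(c, a ⊗ b) × F a × G b` in `C̄`. Coends and products
of bisets are computed separately at the levels `0` (over `Q`) and `1` (over `M`). -/
def Psh.tensor (F G : 𝓜.Psh) : 𝓜.Psh :=
  Psh.mk (day F.zero G.zero) (day F.one G.one) (dayStr F G)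

theorem day_map_str {F F' G G' : 𝓜.Psh} (α : Nat₁ F F') (β : Nat₁ G G') :
    day.map (Psh.nat₁ α) (Psh.nat₁ β) ≫ dayStr F' G' =
      dayStr F G ≫ Functor.whiskerLeft 𝓜.functor.op
        (day.map (Psh.nat₀ α.toNat₀) (Psh.nat₀ β.toNat₀)) := by
  ext c q
  induction q using DayObj.ind with
  | h f x y =>
    rename_i a b
    have e₁ := Biset.Hom.comm (α.app (op a)) x
    have e₂ := Biset.Hom.comm (β.app (op b)) y
    exact congrArg₂ (fun v w => DayObj.mk (P := F'.zero) (R := G'.zero) (c := c.unop.ob)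
      (a := a.ob) (b := b.ob) (𝓜.functor.map f) v w) e₁ e₂

/-- The Day convolution on hom-objects. -/
def Psh.tensorHom (F₁ F₂ G₁ G₂ : 𝓜.Psh) :
    (F₁ ⟶[Biset.{u}] G₁) ⊗ (F₂ ⟶[Biset.{u}] G₂) ⟶
      (F₁.tensor F₂ ⟶[Biset.{u}] G₁.tensor G₂) :=
  ⟨fun p => Psh.ofNat₀ (F := F₁.tensor F₂) (G := G₁.tensor G₂)
      (day.map (Psh.nat₀ p.1) (Psh.nat₀ p.2)),
    fun p => Psh.ofNat₁ (F := F₁.tensor F₂) (G := G₁.tensor G₂)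
      (day.map (Psh.nat₀ (Nat₁.toNat₀ p.1)) (Psh.nat₀ (Nat₁.toNat₀ p.2)))
      (day.map (Psh.nat₁ p.1) (Psh.nat₁ p.2)) (day_map_str p.1 p.2),
    fun _ => rfl⟩

variable (𝓜) in
/-- The representable presheaf `y X = C(-, X)`. -/
def yonedaPsh (X : 𝓜.Obj) : 𝓜.Psh :=
  Psh.mk (yoneda.obj X.ob) (yoneda.obj X)
    { app := fun Y => ↾(fun f : Y.unop ⟶ X => (𝓜.functor.map f : Y.unop.ob ⟶ X.ob))
      naturality := fun Y Z g => by
        ext f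
        exact 𝓜.functor.map_comp g.unop f }

theorem J_whiskerRight {X Y : 𝓜.Obj} (f : X ⟶ Y) (Z : 𝓜.Obj) :
    𝓜.functor.map (f ▷ Z) = (𝓜.functor.map f ▷ Z.ob : X.ob ⊗ Z.ob ⟶ Y.ob ⊗ Z.ob) :=
  (𝓜.J_tensor f (𝓜.id Z.ob)).trans
    ((congrArg (fun k => 𝓜.J f ⊗ₘ k) (𝓜.J_id Z.ob)).trans (tensorHom_id _ _))

theorem J_whiskerLeft (X : 𝓜.Obj) {Y Z : 𝓜.Obj} (f : Y ⟶ Z) :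
    𝓜.functor.map (X ◁ f) = (X.ob ◁ 𝓜.functor.map f : X.ob ⊗ Y.ob ⟶ X.ob ⊗ Z.ob) :=
  (𝓜.J_tensor (𝓜.id X.ob) f).trans
    ((congrArg (fun k => k ⊗ₘ 𝓜.J f) (𝓜.J_id X.ob)).trans (id_tensorHom _ _))

theorem J_comp₂ {W X Y Z : 𝓜.Obj} (f : W ⟶ X) (g : X ⟶ Y) (h : Y ⟶ Z) {k : X.ob ⟶ Y.ob}
    {l : Y.ob ⟶ Z.ob} (hg : 𝓜.functor.map g = k) (hh : 𝓜.functor.map h = l) :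
    𝓜.functor.map (f ≫ g ≫ h) = (𝓜.functor.map f : W.ob ⟶ X.ob) ≫ k ≫ l := by
  subst hg hh
  exact (𝓜.functor.map_comp f (g ≫ h)).trans (congrArg (fun m => 𝓜.functor.map f ≫ m)
    (𝓜.functor.map_comp g h))

theorem day_assoc_str (F G H : 𝓜.Psh) :
    day.assoc F.one G.one H.one ≫ dayStr F (G.tensor H) =
      dayStr (F.tensor G) H ≫ Functor.whiskerLeft 𝓜.functor.op
        (day.assoc F.zero G.zero H.zero) := by
  ext c q
  induction q using DayObj.ind with
  | h f q z =>
    rename_i e b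
    induction q using DayObj.ind with
    | h g x y =>
      rename_i a d
      exact congrArg₂ (fun v w => DayObj.mk (P := F.zero) (R := day G.zero H.zero) (c := c.unop.ob)
          (a := a.ob) (b := d.ob ⊗ b.ob) v (F.str.app (op a) x)
          (DayObj.mk (P := G.zero) (R := H.zero) (c := d.ob ⊗ b.ob) (a := d.ob) (b := b.ob) w
            (G.str.app (op d) y) (H.str.app (op b) z)))
        (J_comp₂ f (g ▷ b) (α_ a d b).hom (J_whiskerRight g b) (𝓜.J_assoc a.ob d.ob b.ob))
        (𝓜.functor.map_id (d ⊗ b))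

theorem day_leftUnitor_str (F : 𝓜.Psh) :
    day.leftUnitor F.one ≫ F.str =
      dayStr (𝓜.yonedaPsh (𝟙_ 𝓜.Obj)) F ≫ Functor.whiskerLeft 𝓜.functor.op
        (day.leftUnitor F.zero) := by
  ext c q
  induction q using DayObj.ind with
  | h f i y =>
    rename_i a b
    refine (NatTrans.naturality_apply F.str _ y).trans ?_
    exact congrArg (fun k : c.unop.ob ⟶ b.ob => F.zero.map k.op (F.str.app (op b) y))
      (J_comp₂ f ((show a ⟶ 𝟙_ 𝓜.Obj from i) ▷ b) (λ_ b).hom (J_whiskerRight _ b)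
        (𝓜.J_left b.ob))

theorem day_rightUnitor_str (F : 𝓜.Psh) :
    day.rightUnitor F.one ≫ F.str =
      dayStr F (𝓜.yonedaPsh (𝟙_ 𝓜.Obj)) ≫ Functor.whiskerLeft 𝓜.functor.op
        (day.rightUnitor F.zero) := by
  ext c q
  induction q using DayObj.ind with
  | h f x i =>
    rename_i a b
    refine (NatTrans.naturality_apply F.str _ x).trans ?_
    exact congrArg (fun k : c.unop.ob ⟶ a.ob => F.zero.map k.op (F.str.app (op a) x))
      (J_comp₂ f (a ◁ (show b ⟶ 𝟙_ 𝓜.Obj from i)) (ρ_ a).hom (J_whiskerLeft a _)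
        (𝓜.J_right a.ob))

theorem day_braiding_str (F G : 𝓜.Psh) :
    day.braiding F.one G.one ≫ dayStr G F =
      dayStr F G ≫ Functor.whiskerLeft 𝓜.functor.op (day.braiding F.zero G.zero) := by
  ext c q
  induction q using DayObj.ind with
  | h f x y =>
    rename_i a b
    exact congrArg (fun k => DayObj.mk (P := G.zero) (R := F.zero) (c := c.unop.ob) (a := b.ob)
        (b := a.ob) k (G.str.app (op b) y) (F.str.app (op a) x))
      ((𝓜.functor.map_comp f (β_ a b).hom).trans
        (congrArg (fun k => 𝓜.functor.map f ≫ k) (𝓜.J_braid a.ob b.ob)))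

variable (𝓜) in
/-- The symmetric monoidal structure of `C̄` given by the Day convolution. -/
def dayTensor : TensorData Biset.{u} 𝓜.Psh where
  unit := 𝓜.yonedaPsh (𝟙_ 𝓜.Obj)
  obj := Psh.tensor
  hom := Psh.tensorHom
  assoc F G H := Biset.point (Psh.ofNat₁ (F := (F.tensor G).tensor H) (G := F.tensor (G.tensor H))
    (day.assoc F.zero G.zero H.zero) (day.assoc F.one G.one H.one) (day_assoc_str F G H))
  leftUnitor F := Biset.point (Psh.ofNat₁ (F := (𝓜.yonedaPsh (𝟙_ 𝓜.Obj)).tensor F) (G := F)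
    (day.leftUnitor F.zero) (day.leftUnitor F.one) (day_leftUnitor_str F))
  rightUnitor F := Biset.point (Psh.ofNat₁ (F := F.tensor (𝓜.yonedaPsh (𝟙_ 𝓜.Obj))) (G := F)
    (day.rightUnitor F.zero) (day.rightUnitor F.one) (day_rightUnitor_str F))
  braiding F G := Biset.point (Psh.ofNat₁ (F := F.tensor G) (G := G.tensor F)
    (day.braiding F.zero G.zero) (day.braiding F.one G.one) (day_braiding_str F G))

end Interpretation

namespace Interpretation

variable {𝓜 : Interpretation Q}

/-- A `Biset`-functor `F : Cᵒᵖ → Biset` is smooth if `F⁰ : Qᵒᵖ ⥤ Set` preserves binary products. -/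
def Psh.IsSmooth (F : 𝓜.Psh) : Prop := prodPreserving Q F.zero

variable (𝓜) in
/-- The full `Biset`-subcategory `C̃` of smooth functors. -/
abbrev Smooth : Type (u + 1) := FullSub (Psh.IsSmooth (𝓜 := 𝓜))

variable (𝓜) in
/-- The inclusion `i : C̃ → C̄`. -/
def incl : EnrichedFunctor Biset.{u} 𝓜.Smooth 𝓜.Psh := FullSub.incl _

/-- The functor `F⁰ : Qᵒᵖ ⥤ Set` of a `Biset`-functor `F : Cᵒᵖ → Set`. -/
def SetPsh.zero (F : 𝓜.SetPsh) : Qᵒᵖ ⥤ Type u where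
  obj X := F.obj (op ⟨X.unop⟩)
  map {X Y} g := ↾(map₀ F (X := op ⟨X.unop⟩) (Y := op ⟨Y.unop⟩) g.unop)
  map_id X := by
    ext x
    exact congrFun (map_id₀ F (op ⟨X.unop⟩)) x
  map_comp {X Y Z} f g := by
    ext x
    exact congrFun (map_comp₀ F (X := op ⟨X.unop⟩) (Y := op ⟨Y.unop⟩) (Z := op ⟨Z.unop⟩)
      f.unop g.unop) x

/-- Smoothness of a `Biset`-functor `Cᵒᵖ → Set`. -/
def SetPsh.IsSmooth (F : 𝓜.SetPsh) : Prop := prodPreserving Q F.zero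

variable (𝓜) in
/-- The full `Biset`-subcategory of smooth functors `Cᵒᵖ → Set`. -/
abbrev SetSmooth : Type (u + 1) := FullSub (SetPsh.IsSmooth (𝓜 := 𝓜))

variable (𝓜)

/-- `Ū₀`, composition with `U₀`. -/
def Ubar : EnrichedFunctor Biset.{u} 𝓜.Psh 𝓜.SetPsh := postcompose Biset.U₀

/-- `Δ̄`, composition with `Δ`. -/
def Deltabar : EnrichedFunctor Biset.{u} 𝓜.SetPsh 𝓜.Psh := postcompose Biset.Δ

/-- `T̄ = Δ̄ ∘ Ū₀`. -/
def Tbar : EnrichedFunctor Biset.{u} 𝓜.Psh 𝓜.Psh := 𝓜.Ubar.comp Biset.{u} 𝓜.Deltabar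

/-- The restriction `Ū₀'` of `Ū₀` to smooth functors. -/
def Utilde : EnrichedFunctor Biset.{u} 𝓜.Smooth 𝓜.SetSmooth :=
  FullSub.restrict 𝓜.Ubar (fun _ h => h)

/-- The restriction `Δ̄'` of `Δ̄` to smooth functors. -/
def Deltatilde : EnrichedFunctor Biset.{u} 𝓜.SetSmooth 𝓜.Smooth :=
  FullSub.restrict 𝓜.Deltabar (fun _ h => h)

/-- `T̃ = Δ̄' ∘ Ū₀'`. -/
def Ttilde : EnrichedFunctor Biset.{u} 𝓜.Smooth 𝓜.Smooth :=
  𝓜.Utilde.comp Biset.{u} 𝓜.Deltatilde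

/-- The unit of `T̄`, that is, of the adjunction of `Ū₀` and `Δ̄`: at `X` it is
`(id, F X) : F X → ((F X)₀, (F X)₀, id)`. -/
def etaBar (F : 𝓜.Psh) : EMap Biset.{u} F (𝓜.Tbar.obj F) :=
  Biset.point (X := F ⟶[Biset.{u}] 𝓜.Tbar.obj F)
    { app := fun X => ⟨fun x => x, (F.obj X).map, fun _ => rfl⟩
      natural₁ := fun {X Y} f => Biset.hom_ext (fun _ => rfl)
        (fun x => Biset.Hom.comm (map₁ F f) x)
      natural₀ := fun _ => rfl }

/-- The multiplication of `T̄`, induced by the counit `U₀ (Δ S) = S`. -/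
def muBar (F : 𝓜.Psh) : EMap Biset.{u} (𝓜.Tbar.obj (𝓜.Tbar.obj F)) (𝓜.Tbar.obj F) :=
  Biset.point (X := 𝓜.Tbar.obj (𝓜.Tbar.obj F) ⟶[Biset.{u}] 𝓜.Tbar.obj F)
    { app := fun X => ⟨fun x => x, fun x => x, fun _ => rfl⟩
      natural₁ := fun _ => rfl
      natural₀ := fun _ => rfl }

/-- The unit of `T̃`. -/
def etaTilde (F : 𝓜.Smooth) : EMap Biset.{u} F (𝓜.Ttilde.obj F) := 𝓜.etaBar F.obj

/-- The multiplication of `T̃`. -/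
def muTilde (F : 𝓜.Smooth) :
    EMap Biset.{u} (𝓜.Ttilde.obj (𝓜.Ttilde.obj F)) (𝓜.Ttilde.obj F) := 𝓜.muBar F.obj

/-- The isomorphism `β : i T̃ F → T̄ i F`; both sides are the same functor. -/
def beta (F : 𝓜.Smooth) :
    EMap Biset.{u} (𝓜.incl.obj (𝓜.Ttilde.obj F)) (𝓜.Tbar.obj (𝓜.incl.obj F)) :=
  eId Biset.{u} (𝓜.Tbar.obj F.obj)

/-- The inverse of `β`. -/
def betaInv (F : 𝓜.Smooth) :
    EMap Biset.{u} (𝓜.Tbar.obj (𝓜.incl.obj F)) (𝓜.incl.obj (𝓜.Ttilde.obj F)) :=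
  eId Biset.{u} (𝓜.Tbar.obj F.obj)

/-- The strength `t̄ : F ⊗ T̄ G → T̄ (F ⊗ G)`: the composite of
`∫ t : ∫^{a,b} C(c, a ⊗ b) × F a × T (G b) → ∫^{a,b} T (C(c, a ⊗ b) × F a × G b)` and the canonical
map to `T ∫^{a,b} C(c, a ⊗ b) × F a × G b`, where `t` is the strength of the monad `T = Δ U₀` on
bisets. -/
def tBar (F G : 𝓜.Psh) :
    EMap Biset.{u} (𝓜.dayTensor.obj F (𝓜.Tbar.obj G)) (𝓜.Tbar.obj (𝓜.dayTensor.obj F G)) :=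
  Biset.point (Psh.ofNat₁ (F := F.tensor (𝓜.Tbar.obj G)) (G := 𝓜.Tbar.obj (F.tensor G))
    (𝟙 (day F.zero G.zero)) (dayStr F (𝓜.Tbar.obj G)) rfl)

variable {𝓜}

/-- `i L̃ F`, given by `(L̃ F)(X) = ((i L F⁰) X, (F X)₁, η ∘ F X)`. -/
noncomputable def Psh.reflect (F : 𝓜.Psh) : 𝓜.Psh :=
  Psh.mk (refl₀.obj F.zero) F.one
    (F.str ≫ Functor.whiskerLeft 𝓜.functor.op (reflUnit₀ F.zero))

theorem reflect_str {F G : 𝓜.Psh} (α : Nat₁ F G) :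
    Psh.nat₁ α ≫ G.str ≫ Functor.whiskerLeft 𝓜.functor.op (reflUnit₀ G.zero) =
      (F.str ≫ Functor.whiskerLeft 𝓜.functor.op (reflUnit₀ F.zero)) ≫
        Functor.whiskerLeft 𝓜.functor.op (refl₀.map (Psh.nat₀ α.toNat₀)) := by
  have h := reflectorAdj.unit.naturality (Psh.nat₀ α.toNat₀)
  rw [← Category.assoc, Psh.nat_comm, Category.assoc, Category.assoc,
    ← Functor.whiskerLeft_comp, ← Functor.whiskerLeft_comp]
  exact congrArg (fun k => F.str ≫ Functor.whiskerLeft 𝓜.functor.op k) h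

variable (𝓜) in
/-- The reflection `L̃ : C̄ → C̃`. -/
noncomputable def Ltilde : EnrichedFunctor Biset.{u} 𝓜.Psh 𝓜.Smooth where
  obj F := ⟨F.reflect, (reflector.obj F.zero).property⟩
  map F G :=
    ⟨fun β => Psh.ofNat₀ (F := F.reflect) (G := G.reflect) (refl₀.map (Psh.nat₀ β)),
      fun α => Psh.ofNat₁ (F := F.reflect) (G := G.reflect)
        (refl₀.map (Psh.nat₀ (Nat₁.toNat₀ α))) (Psh.nat₁ (F := F) (G := G) α) (reflect_str α), fun _ => rfl⟩
  map_id F :=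
    Biset.hom_ext
      (fun _ => Nat₀.ext (funext fun X => funext fun x => ConcreteCategory.congr_hom
        (NatTrans.congr_app (refl₀.map_id F.zero) (op X.unop.ob)) x))
      (fun _ => Nat₁.ext (funext fun X => Biset.hom_ext
        (fun x => ConcreteCategory.congr_hom
          (NatTrans.congr_app (refl₀.map_id F.zero) (op X.unop.ob)) x)
        (fun _ => rfl)))
  map_comp F G H :=
    Biset.hom_ext
      (fun p => Nat₀.ext (funext fun X => funext fun x => ConcreteCategory.congr_hom
        (NatTrans.congr_app (refl₀.map_comp (Psh.nat₀ p.1) (Psh.nat₀ p.2)) (op X.unop.ob)) x))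
      (fun p => Nat₁.ext (funext fun X => Biset.hom_ext
        (fun x => ConcreteCategory.congr_hom (NatTrans.congr_app
          (refl₀.map_comp (Psh.nat₀ (Nat₁.toNat₀ p.1)) (Psh.nat₀ (Nat₁.toNat₀ p.2)))
            (op X.unop.ob)) x)
        (fun _ => rfl)))

variable (𝓜) in
/-- The unit `η : F → i L̃ F`. -/
noncomputable def unitL (F : 𝓜.Psh) : EMap Biset.{u} F (𝓜.incl.obj (𝓜.Ltilde.obj F)) :=
  Biset.point (Psh.ofNat₁ (F := F) (G := F.reflect) (reflUnit₀ F.zero) (𝟙 F.one)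
    (Category.id_comp _))

theorem liftL_str {F : 𝓜.Psh} {G : 𝓜.Smooth} (α : Nat₁ F G.obj) :
    Psh.nat₁ α ≫ G.obj.str =
      (F.str ≫ Functor.whiskerLeft 𝓜.functor.op (reflUnit₀ F.zero)) ≫
        Functor.whiskerLeft 𝓜.functor.op (reflLift₀ G.prop (Psh.nat₀ α.toNat₀)) := by
  rw [Psh.nat_comm, Category.assoc, ← Functor.whiskerLeft_comp]
  exact congrArg (fun k => F.str ≫ Functor.whiskerLeft 𝓜.functor.op k)
    (reflLift₀_fac G.prop (Psh.nat₀ α.toNat₀)).symm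

/-- The map `L̃ F → G` corresponding to a map `F → i G`. -/
noncomputable def liftL {F : 𝓜.Psh} {G : 𝓜.Smooth} (α : Nat₁ F G.obj) :
    EMap Biset.{u} (𝓜.Ltilde.obj F) G :=
  Biset.point (X := F.reflect ⟶[Biset.{u}] G.obj)
    (Psh.ofNat₁ (F := F.reflect) (G := G.obj) (reflLift₀ G.prop (Psh.nat₀ α.toNat₀))
      (Psh.nat₁ (F := F) (G := G.obj) α) (liftL_str α))

variable (𝓜) in
/-- The counit `ε : L̃ i F → F`. -/
noncomputable def counitL (F : 𝓜.Smooth) : EMap Biset.{u} (𝓜.Ltilde.obj (𝓜.incl.obj F)) F :=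
  liftL (id₁ F.obj)

theorem extendL_str [∀ X : Q, PreservesColimitsOfShape (Discrete WalkingPair) (tensorRight X)]
    {F H : 𝓜.Psh} {G : 𝓜.Smooth} (α : Nat₁ (F.tensor H) G.obj) :
    (show day F.one H.one ⟶ G.obj.one from Psh.nat₁ (F := F.tensor H) (G := G.obj) α) ≫
        G.obj.str =
      dayStr F.reflect H ≫ Functor.whiskerLeft 𝓜.functor.op
        (dayExtend (P := F.zero) (S := H.zero) G.prop (Psh.nat₀ α.toNat₀)) := by
  refine (Psh.nat_comm α).trans ?_
  ext c q
  induction q using DayObj.ind with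
  | h f x y =>
    rename_i a b
    exact (ConcreteCategory.congr_hom (NatTrans.congr_app (dayExtend_fac (P := F.zero)
      (S := H.zero) G.prop (Psh.nat₀ α.toNat₀)) (op c.unop.ob))
      (DayObj.mk (P := F.zero) (R := H.zero) (c := c.unop.ob) (a := a.ob) (b := b.ob)
        (𝓜.functor.map f) (F.str.app (op a) x) (H.str.app (op b) y))).symm

/-- The extension `i L̃ F ⊗ H → i G` of a map `F ⊗ H → i G` along the unit `F → i L̃ F`. -/
noncomputable def extendL
    [∀ X : Q, PreservesColimitsOfShape (Discrete WalkingPair) (tensorRight X)]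
    {F H : 𝓜.Psh} {G : 𝓜.Smooth} (α : Nat₁ (F.tensor H) G.obj) :
    Nat₁ (F.reflect.tensor H) G.obj :=
  Psh.ofNat₁ (F := F.reflect.tensor H) (G := G.obj) (dayExtend G.prop (Psh.nat₀ α.toNat₀))
    (Psh.nat₁ (F := F.tensor H) (G := G.obj) α) (extendL_str α)

theorem yonedaPsh_isSmooth (X : 𝓜.Obj) : (𝓜.yonedaPsh X).IsSmooth :=
  inferInstanceAs (PreservesLimitsOfShape (Discrete WalkingPair) (yoneda.obj X.ob))

variable (𝓜) in
/-- The symmetric monoidal structure of `C̃`: `F ⊗ G = L̃ (i F ⊗ i G)`, with unit `y I`. The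
associator is the unique map whose composite with the isomorphism
`L̃ (η ⊗ i H) : L̃ ((i F ⊗ i G) ⊗ i H) → L̃ (i L̃ (i F ⊗ i G) ⊗ i H)` is the composite of `L̃ α` with
`L̃ (i F ⊗ η)`. -/
noncomputable def lamTensor
    [∀ X : Q, PreservesColimitsOfShape (Discrete WalkingPair) (tensorRight X)] :
    TensorData Biset.{u} 𝓜.Smooth where
  unit := ⟨𝓜.yonedaPsh (𝟙_ 𝓜.Obj), yonedaPsh_isSmooth _⟩
  obj F G := 𝓜.Ltilde.obj (𝓜.dayTensor.obj (𝓜.incl.obj F) (𝓜.incl.obj G))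
  hom F₁ F₂ G₁ G₂ := 𝓜.dayTensor.hom F₁.obj F₂.obj G₁.obj G₂.obj ≫ 𝓜.Ltilde.map _ _
  assoc F G H := liftL (extendL (F := F.obj.tensor G.obj) (H := H.obj)
    (G := 𝓜.Ltilde.obj (F.obj.tensor (G.obj.tensor H.obj).reflect))
    (Biset.Hom.one
      (((𝓜.dayTensor.assoc F.obj G.obj H.obj).comp
        (𝓜.dayTensor.tensorMap (eId _ F.obj) (𝓜.unitL (𝓜.dayTensor.obj G.obj H.obj)))).comp
        (𝓜.unitL _)) PUnit.unit))
  leftUnitor F := ((𝓜.dayTensor.leftUnitor F.obj).image 𝓜.Ltilde).comp (𝓜.counitL F)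
  rightUnitor F := ((𝓜.dayTensor.rightUnitor F.obj).image 𝓜.Ltilde).comp (𝓜.counitL F)
  braiding F G := (𝓜.dayTensor.braiding F.obj G.obj).image 𝓜.Ltilde

variable (𝓜) in
/-- `ρ : L̃ T̄ F → T̃ L̃ F`. -/
noncomputable def rho (F : 𝓜.Psh) :
    EMap Biset.{u} (𝓜.Ltilde.obj (𝓜.Tbar.obj F)) (𝓜.Ttilde.obj (𝓜.Ltilde.obj F)) :=
  ((((𝓜.unitL F).image 𝓜.Tbar).image 𝓜.Ltilde).comp
    ((𝓜.betaInv (𝓜.Ltilde.obj F)).image 𝓜.Ltilde)).comp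
      (𝓜.counitL (𝓜.Ttilde.obj (𝓜.Ltilde.obj F)))

variable (𝓜) in
/-- The strength `t̃ : F ⊗ T̃ G → T̃ (F ⊗ G)` of `T̃`, that is, `ρ ∘ L̃ t̄ ∘ L̃ (i F ⊗ β)`. -/
noncomputable def tTilde
    [∀ X : Q, PreservesColimitsOfShape (Discrete WalkingPair) (tensorRight X)]
    (F G : 𝓜.Smooth) :
    EMap Biset.{u} (𝓜.lamTensor.obj F (𝓜.Ttilde.obj G)) (𝓜.Ttilde.obj (𝓜.lamTensor.obj F G)) :=
  (((𝓜.dayTensor.tensorMap (eId _ (𝓜.incl.obj F)) (𝓜.beta G)).image 𝓜.Ltilde).comp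
    ((𝓜.tBar (𝓜.incl.obj F) (𝓜.incl.obj G)).image 𝓜.Ltilde)).comp
      (𝓜.rho (𝓜.dayTensor.obj (𝓜.incl.obj F) (𝓜.incl.obj G)))

end Interpretation

end Model

/-! A map of `C̃` has a level 0, a natural transformation of presheaves on `Q`, and a level 1, a
natural transformation of presheaves on `M`. An equation between maps may be checked at each level
separately (`Psh.hom_ext`, `level_ext`). At level 1 the reflection does nothing and the tensor
product is the plain Day convolution over `M`; at level 0 it is the Day convolution over `Q`
followed by the reflection into product preserving presheaves.

Both tensor products are generated by pure tensors `x ⊗ y`, as far as maps into admissible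
presheaves are concerned: all presheaves at level 1, the product preserving ones at level 0.
Distributivity makes the admissible class closed under the shifts `Z(- ⊗ b)` and `Z(a ⊗ -)`, so
iterated tensor products are generated by iterated pure tensors. There each coherence law becomes
the corresponding law of the base category. `PshMonoidal` carries out this argument once;
`dayMonoidal` and `reflMonoidal` are its two instances.

The monad replaces `F¹` by `F⁰ ∘ J`. At level 0 its unit, multiplication, strength and costrength
are all identities. At level 1, with `φ` the structure map from level 1 to level 0, the strength
sends `x ⊗ y` to `φ x ⊗ y` and the costrength sends it to `x ⊗ φ y` (`level₁_tTilde_app_pure`,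
`level₁_sTilde_app_pure`). The laws of a strength can be read off from these formulas. For
commutativity, the level 1 elements of `T̃ F` and `T̃ G` are level 0 elements of `F` and `G`, so
both composites send `x ⊗ y` to `x ⊗ y`. -/

section Presheaf

variable {K : Type u} [Category.{u} K] {P R : Kᵒᵖ ⥤ Type u}

/-! ### Preliminaries on presheaves and on symmetric monoidal categories. -/

theorem psh_map_map (P : Kᵒᵖ ⥤ Type u) {a b c : K} (f : a ⟶ b) (g : b ⟶ c) (x : P.obj (op c)) :
    P.map f.op (P.map g.op x) = P.map (f ≫ g).op x := by
  rw [op_comp, Functor.map_comp_apply]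

theorem psh_app_map (m : P ⟶ R) {a b : K} (f : a ⟶ b) (x : P.obj (op b)) :
    m.app (op a) (P.map f.op x) = R.map f.op (m.app (op b) x) :=
  NatTrans.naturality_apply m f.op x

theorem psh_id_app {a : Kᵒᵖ} (x : P.obj a) : (𝟙 P : P ⟶ P).app a x = x := rfl

end Presheaf

section

variable {K : Type u} [Category.{u} K] [MonoidalCategory K] [SymmetricCategory K]

/-- An instance of symmetric coherence. It allows the inverse of the associator of presheaves to be
defined from the associator and the symmetry alone (`assocInv`). -/
theorem braiding_conj_associator (a b c : K) :
    (β_ a (b ⊗ c)).hom ≫ (β_ b c).hom ▷ a ≫ (α_ c b a).hom ≫ c ◁ (β_ b a).hom ≫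
      (β_ c (a ⊗ b)).hom = (α_ a b c).inv := by
  have h₁ := BraidedCategory.hexagon_forward b c a
  have h₂ := BraidedCategory.hexagon_forward a b c
  have h₃ := BraidedCategory.hexagon_forward b a c
  have h₄ := BraidedCategory.hexagon_reverse a b c
  have h₅ := BraidedCategory.braiding_naturality_right b (β_ a c).hom
  have h₆ : (β_ a b).hom ▷ c ≫ (β_ b a).hom ▷ c = 𝟙 _ := by
    rw [← comp_whiskerRight, SymmetricCategory.symmetry, id_whiskerRight]
  rw [← cancel_epi (α_ a b c).hom, Iso.hom_inv_id]
  -- Four hexagons and one naturality square regroup the transpositions until only the double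
  -- braiding of `a ⊗ b` with `c` is left.
  calc _ = ((α_ a b c).hom ≫ (β_ a (b ⊗ c)).hom) ≫
          ((β_ b c).hom ▷ a ≫ (α_ c b a).hom ≫ c ◁ (β_ b a).hom) ≫ (β_ c (a ⊗ b)).hom := by simp
    _ = ((α_ a b c).hom ≫ (β_ a (b ⊗ c)).hom ≫ (α_ b c a).hom) ≫ (β_ b (c ⊗ a)).hom ≫
          (α_ c a b).hom ≫ (β_ c (a ⊗ b)).hom := by rw [← h₁]; simp
    _ = ((β_ a b).hom ▷ c ≫ (α_ b a c).hom) ≫ (b ◁ (β_ a c).hom ≫ (β_ b (c ⊗ a)).hom) ≫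
          (α_ c a b).hom ≫ (β_ c (a ⊗ b)).hom := by rw [h₂]; simp
    _ = (β_ a b).hom ▷ c ≫ ((α_ b a c).hom ≫ (β_ b (a ⊗ c)).hom ≫ (α_ a c b).hom) ≫
          (α_ a c b).inv ≫ (β_ a c).hom ▷ b ≫ (α_ c a b).hom ≫ (β_ c (a ⊗ b)).hom := by
      rw [h₅]; simp
    _ = ((β_ a b).hom ▷ c ≫ (β_ b a).hom ▷ c) ≫ (α_ a b c).hom ≫
          (a ◁ (β_ b c).hom ≫ (α_ a c b).inv ≫ (β_ a c).hom ▷ b) ≫ (α_ c a b).hom ≫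
            (β_ c (a ⊗ b)).hom := by rw [h₃]; simp
    _ = (β_ (a ⊗ b) c).hom ≫ (β_ c (a ⊗ b)).hom := by rw [h₆, ← h₄]; simp
    _ = _ := SymmetricCategory.symmetry _ _

end

/-! ### Tensor products of presheaves generated by pure tensors. -/

/-- A tensor product of presheaves of sets on a monoidal category, with values in a class of
presheaves that is closed under the shifts `Z(- ⊗ b)` and `Z(a ⊗ -)`. It is generated by the pure
tensors, as far as maps to presheaves of that class are concerned. -/
structure PshTensor (K : Type u) [Category.{u} K] [MonoidalCategory K] where
  mem : ObjectProperty (Kᵒᵖ ⥤ Type u)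
  mem_shiftRight {Z : Kᵒᵖ ⥤ Type u} (b : K) : mem Z → mem ((tensorRight b).op ⋙ Z)
  mem_shiftLeft {Z : Kᵒᵖ ⥤ Type u} (a : K) : mem Z → mem ((tensorLeft a).op ⋙ Z)
  obj (P R : Kᵒᵖ ⥤ Type u) : Kᵒᵖ ⥤ Type u
  obj_mem (P R : Kᵒᵖ ⥤ Type u) : mem (obj P R)
  pure {P R : Kᵒᵖ ⥤ Type u} {a b : K} (x : P.obj (op a)) (y : R.obj (op b)) :
    (obj P R).obj (op (a ⊗ b))
  map_pure {P R : Kᵒᵖ ⥤ Type u} {a a' b b' : K} (s : a ⟶ a') (t : b ⟶ b') (x : P.obj (op a'))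
    (y : R.obj (op b')) :
    (obj P R).map (s ⊗ₘ t).op (pure x y) = pure (P.map s.op x) (R.map t.op y)
  hom_ext {P R Z : Kᵒᵖ ⥤ Type u} (hZ : mem Z) {f g : obj P R ⟶ Z}
    (h : ∀ {a b : K} (x : P.obj (op a)) (y : R.obj (op b)),
      f.app (op (a ⊗ b)) (pure x y) = g.app (op (a ⊗ b)) (pure x y)) : f = g

namespace PshTensor

variable {K : Type u} [Category.{u} K] [MonoidalCategory K] (T : PshTensor K)
  {P P' P'' R R' R'' S S' U Z : Kᵒᵖ ⥤ Type u}

theorem pure_map_left {a a' b : K} (s : a ⟶ a') (x : P.obj (op a')) (y : R.obj (op b)) :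
    T.pure (P.map s.op x) y = (T.obj P R).map (s ▷ b).op (T.pure x y) := by
  rw [← tensorHom_id, T.map_pure, op_id, Functor.map_id_apply]

theorem pure_map_right {a b b' : K} (t : b ⟶ b') (x : P.obj (op a)) (y : R.obj (op b')) :
    T.pure x (R.map t.op y) = (T.obj P R).map (a ◁ t).op (T.pure x y) := by
  rw [← id_tensorHom, T.map_pure, op_id, Functor.map_id_apply]

/-- The map `w ↦ f (w ⊗ z)`. -/
def evalRight (f : T.obj P R ⟶ Z) {b : K} (z : R.obj (op b)) : P ⟶ (tensorRight b).op ⋙ Z where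
  app a := ↾(fun w => f.app (op (a.unop ⊗ b)) (T.pure w z))
  naturality a a' s := by
    ext w
    refine (congrArg (fun q => f.app (op (a'.unop ⊗ b)) q) (T.pure_map_left s.unop w z)).trans ?_
    exact NatTrans.naturality_apply f (s.unop ▷ b).op _

/-- The map `w ↦ f (x ⊗ w)`. -/
def evalLeft (f : T.obj P R ⟶ Z) {a : K} (x : P.obj (op a)) : R ⟶ (tensorLeft a).op ⋙ Z where
  app b := ↾(fun w => f.app (op (a ⊗ b.unop)) (T.pure x w))
  naturality b b' t := by
    ext w
    refine (congrArg (fun q => f.app (op (a ⊗ b'.unop)) q) (T.pure_map_right t.unop x w)).trans ?_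
    exact NatTrans.naturality_apply f (a ◁ t.unop).op _

/-- Fixing the second factor turns a map out of `M ⊗ S` into maps `M ⟶ Z(- ⊗ b)`. Their target is
again in the class, so when `M` is itself a tensor product, generation by pure tensors applies once
more. -/
theorem hom_ext_left {M : Kᵒᵖ ⥤ Type u} (hZ : T.mem Z)
    {f g : T.obj M S ⟶ Z}
    (h : ∀ {b : K} (z : S.obj (op b)), T.evalRight f z = T.evalRight g z) : f = g :=
  T.hom_ext hZ (fun {a b} w z => ConcreteCategory.congr_hom (NatTrans.congr_app (h z) (op a)) w)

theorem hom_ext_right {M : Kᵒᵖ ⥤ Type u} (hZ : T.mem Z)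
    {f g : T.obj P M ⟶ Z}
    (h : ∀ {a : K} (x : P.obj (op a)), T.evalLeft f x = T.evalLeft g x) : f = g :=
  T.hom_ext hZ (fun {a b} x w => ConcreteCategory.congr_hom (NatTrans.congr_app (h x) (op b)) w)

theorem hom_ext₃ (hZ : T.mem Z) {f g : T.obj (T.obj P R) S ⟶ Z}
    (h : ∀ {a b c : K} (x : P.obj (op a)) (y : R.obj (op b)) (z : S.obj (op c)),
      f.app (op ((a ⊗ b) ⊗ c)) (T.pure (T.pure x y) z) =
        g.app (op ((a ⊗ b) ⊗ c)) (T.pure (T.pure x y) z)) : f = g :=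
  T.hom_ext_left hZ (fun {c} z => T.hom_ext (T.mem_shiftRight c hZ) (fun x y => h x y z))

/-- The other bracketing, which requires the shifts `Z(a ⊗ -)`. It serves to check the second
inverse law of the associator, whose source is `P ⊗ (R ⊗ S)`. -/
theorem hom_ext₃_right (hZ : T.mem Z) {f g : T.obj P (T.obj R S) ⟶ Z}
    (h : ∀ {a b c : K} (x : P.obj (op a)) (y : R.obj (op b)) (z : S.obj (op c)),
      f.app (op (a ⊗ (b ⊗ c))) (T.pure x (T.pure y z)) =
        g.app (op (a ⊗ (b ⊗ c))) (T.pure x (T.pure y z))) : f = g :=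
  T.hom_ext_right hZ (fun {a} x => T.hom_ext (T.mem_shiftLeft a hZ) (fun y z => h x y z))

theorem hom_ext₄ (hZ : T.mem Z) {f g : T.obj (T.obj (T.obj P R) S) U ⟶ Z}
    (h : ∀ {a b c d : K} (x : P.obj (op a)) (y : R.obj (op b)) (z : S.obj (op c))
      (w : U.obj (op d)),
      f.app (op (((a ⊗ b) ⊗ c) ⊗ d)) (T.pure (T.pure (T.pure x y) z) w) =
        g.app (op (((a ⊗ b) ⊗ c) ⊗ d)) (T.pure (T.pure (T.pure x y) z) w)) : f = g :=
  T.hom_ext_left hZ (fun {d} w => T.hom_ext₃ (T.mem_shiftRight d hZ) (fun x y z => h x y z w))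

end PshTensor

/-! ### Symmetric monoidal laws, verified on pure tensors. -/

/-- A tensor product of presheaves together with the structure maps of a symmetric monoidal
category, specified by their values on pure tensors. -/
structure PshMonoidal (K : Type u) [Category.{u} K] [MonoidalCategory K] [SymmetricCategory K]
    extends PshTensor K where
  map {P P' R R' : Kᵒᵖ ⥤ Type u} (m : P ⟶ P') (n : R ⟶ R') : obj P R ⟶ obj P' R'
  assoc (P R S : Kᵒᵖ ⥤ Type u) : obj (obj P R) S ⟶ obj P (obj R S)
  leftUnitor {P : Kᵒᵖ ⥤ Type u} (hP : mem P) : obj (yoneda.obj (𝟙_ K)) P ⟶ P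
  rightUnitor {P : Kᵒᵖ ⥤ Type u} (hP : mem P) : obj P (yoneda.obj (𝟙_ K)) ⟶ P
  braiding (P R : Kᵒᵖ ⥤ Type u) : obj P R ⟶ obj R P
  map_app_pure {P P' R R' : Kᵒᵖ ⥤ Type u} (m : P ⟶ P') (n : R ⟶ R') {a b : K}
    (x : P.obj (op a)) (y : R.obj (op b)) :
    (map m n).app (op (a ⊗ b)) (pure x y) = pure (m.app (op a) x) (n.app (op b) y)
  assoc_app_pure {P R S : Kᵒᵖ ⥤ Type u} {a b c : K} (x : P.obj (op a)) (y : R.obj (op b))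
    (z : S.obj (op c)) :
    (assoc P R S).app (op ((a ⊗ b) ⊗ c)) (pure (pure x y) z) =
      (obj P (obj R S)).map (α_ a b c).hom.op (pure x (pure y z))
  leftUnitor_app_pure {P : Kᵒᵖ ⥤ Type u} (hP : mem P) {a b : K} (i : a ⟶ 𝟙_ K)
    (y : P.obj (op b)) :
    (leftUnitor hP).app (op (a ⊗ b)) (pure (P := yoneda.obj (𝟙_ K)) i y) =
      P.map (i ▷ b ≫ (λ_ b).hom).op y
  rightUnitor_app_pure {P : Kᵒᵖ ⥤ Type u} (hP : mem P) {a b : K} (x : P.obj (op a))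
    (i : b ⟶ 𝟙_ K) :
    (rightUnitor hP).app (op (a ⊗ b)) (pure (R := yoneda.obj (𝟙_ K)) x i) =
      P.map (a ◁ i ≫ (ρ_ a).hom).op x
  braiding_app_pure {P R : Kᵒᵖ ⥤ Type u} {a b : K} (x : P.obj (op a)) (y : R.obj (op b)) :
    (braiding P R).app (op (a ⊗ b)) (pure x y) = (obj R P).map (β_ a b).hom.op (pure y x)

namespace PshMonoidal

variable {K : Type u} [Category.{u} K] [MonoidalCategory K] [SymmetricCategory K]
  (T : PshMonoidal K) {P P' P'' R R' R'' S S' U Z : Kᵒᵖ ⥤ Type u}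

theorem map_id (P R : Kᵒᵖ ⥤ Type u) : T.map (𝟙 P) (𝟙 R) = 𝟙 (T.obj P R) :=
  T.hom_ext (T.obj_mem _ _) (fun x y => T.map_app_pure _ _ x y)

theorem map_comp (m : P ⟶ P') (m' : P' ⟶ P'') (n : R ⟶ R') (n' : R' ⟶ R'') :
    T.map (m ≫ m') (n ≫ n') = T.map m n ≫ T.map m' n' := by
  refine T.hom_ext (T.obj_mem _ _) (fun x y => ?_)
  simp only [NatTrans.comp_app_apply, T.map_app_pure]

theorem assoc_natural (m : P ⟶ P') (n : R ⟶ R') (k : S ⟶ S') :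
    T.map (T.map m n) k ≫ T.assoc P' R' S' = T.assoc P R S ≫ T.map m (T.map n k) := by
  refine T.hom_ext₃ (T.obj_mem _ _) (fun x y z => ?_)
  simp only [NatTrans.comp_app_apply, T.map_app_pure, T.assoc_app_pure, psh_app_map]

theorem leftUnitor_natural (hP : T.mem P) (hR : T.mem R) (m : P ⟶ R) :
    T.map (𝟙 _) m ≫ T.leftUnitor hR = T.leftUnitor hP ≫ m := by
  refine T.hom_ext hR (fun x y => ?_)
  simp only [NatTrans.comp_app_apply, T.map_app_pure]
  refine (T.leftUnitor_app_pure hR x _).trans ?_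
  refine Eq.trans ?_ (congrArg _ (T.leftUnitor_app_pure hP x _).symm)
  simp only [psh_app_map]

theorem rightUnitor_natural (hP : T.mem P) (hR : T.mem R) (m : P ⟶ R) :
    T.map m (𝟙 _) ≫ T.rightUnitor hR = T.rightUnitor hP ≫ m := by
  refine T.hom_ext hR (fun x y => ?_)
  simp only [NatTrans.comp_app_apply, T.map_app_pure]
  refine (T.rightUnitor_app_pure hR _ y).trans ?_
  refine Eq.trans ?_ (congrArg _ (T.rightUnitor_app_pure hP _ y).symm)
  simp only [psh_app_map]

theorem braiding_natural (m : P ⟶ P') (n : R ⟶ R') :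
    T.map m n ≫ T.braiding P' R' = T.braiding P R ≫ T.map n m := by
  refine T.hom_ext (T.obj_mem _ _) (fun x y => ?_)
  simp only [NatTrans.comp_app_apply, T.map_app_pure, T.braiding_app_pure, psh_app_map]

theorem symmetry (P R : Kᵒᵖ ⥤ Type u) : T.braiding P R ≫ T.braiding R P = 𝟙 (T.obj P R) := by
  refine T.hom_ext (T.obj_mem _ _) (fun x y => ?_)
  simp only [NatTrans.comp_app_apply, T.braiding_app_pure, psh_app_map, psh_map_map,
    SymmetricCategory.symmetry, op_id, Functor.map_id_apply, psh_id_app]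

/-- Needed for the costrength, whose last factor is a symmetry applied to a swapped pure tensor. -/
theorem braiding_app_map_pure {a b : K} (x : P.obj (op a)) (y : R.obj (op b)) :
    (T.braiding R P).app (op (a ⊗ b)) ((T.obj R P).map (β_ a b).hom.op (T.pure y x)) =
      T.pure x y := by
  rw [← T.braiding_app_pure, ← NatTrans.comp_app_apply, T.symmetry, psh_id_app]

/-- On a pure tensor both composites restrict one and the same element, along the two legs of the
pentagon in `K`. The hexagon is reduced to that of `K` in the same way. -/
theorem pentagon (P R S U : Kᵒᵖ ⥤ Type u) :
    (T.map (T.assoc P R S) (𝟙 U) ≫ T.assoc P (T.obj R S) U) ≫ T.map (𝟙 P) (T.assoc R S U) =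
      T.assoc (T.obj P R) S U ≫ T.assoc P R (T.obj S U) := by
  refine T.hom_ext₄ (T.obj_mem _ _) (fun x y z w => ?_)
  simp only [NatTrans.comp_app_apply, T.map_app_pure, T.assoc_app_pure, psh_app_map,
    T.pure_map_left, T.pure_map_right, psh_id_app, psh_map_map,
    MonoidalCategory.pentagon, Category.assoc]

theorem triangle (hP : T.mem P) (hR : T.mem R) :
    T.assoc P (yoneda.obj (𝟙_ K)) R ≫ T.map (𝟙 P) (T.leftUnitor hR) =
      T.map (T.rightUnitor hP) (𝟙 R) := by
  refine T.hom_ext₃ (T.obj_mem _ _) (fun {a b c} x (y : b ⟶ 𝟙_ K) z => ?_)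
  simp only [NatTrans.comp_app_apply, T.map_app_pure, T.assoc_app_pure, psh_app_map,
    psh_id_app]
  rw [T.leftUnitor_app_pure hR y z, T.rightUnitor_app_pure hP x y]
  simp only [T.pure_map_left, T.pure_map_right, psh_map_map]
  -- An equation between arrows of `K` remains: naturality of the associator in its middle variable,
  -- followed by the triangle.
  congr 3
  simp

theorem hexagon (P R S : Kᵒᵖ ⥤ Type u) :
    (T.assoc P R S ≫ T.braiding P (T.obj R S)) ≫ T.assoc R S P =
      (T.map (T.braiding P R) (𝟙 S) ≫ T.assoc R P S) ≫ T.map (𝟙 R) (T.braiding P S) := by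
  refine T.hom_ext₃ (T.obj_mem _ _) (fun x y z => ?_)
  simp only [NatTrans.comp_app_apply, T.map_app_pure, T.assoc_app_pure, psh_app_map,
    T.pure_map_left, T.pure_map_right, psh_id_app, psh_map_map,
    T.braiding_app_pure, BraidedCategory.hexagon_forward, Category.assoc]

/-- The inverse of the associator, as a conjugate of the associator by symmetries. -/
def assocInv (P R S : Kᵒᵖ ⥤ Type u) : T.obj P (T.obj R S) ⟶ T.obj (T.obj P R) S :=
  (((T.braiding P (T.obj R S) ≫ T.map (T.braiding R S) (𝟙 P)) ≫ T.assoc S R P) ≫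
    T.map (𝟙 S) (T.braiding R P)) ≫ T.braiding S (T.obj P R)

/-- Thanks to the symmetry, no map out of `P ⊗ (R ⊗ S)` has to be built by a separate extension in
the second factor. The five factors restrict along the arrows composed in
`braiding_conj_associator`. -/
theorem assocInv_app_pure {a b c : K} (x : P.obj (op a)) (y : R.obj (op b)) (z : S.obj (op c)) :
    (T.assocInv P R S).app (op (a ⊗ (b ⊗ c))) (T.pure x (T.pure y z)) =
      (T.obj (T.obj P R) S).map (α_ a b c).inv.op (T.pure (T.pure x y) z) := by
  simp only [assocInv, NatTrans.comp_app_apply, T.map_app_pure, T.assoc_app_pure, psh_app_map,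
    T.pure_map_left, T.pure_map_right, psh_id_app, psh_map_map,
    T.braiding_app_pure, Category.assoc, braiding_conj_associator]

theorem assoc_assocInv (P R S : Kᵒᵖ ⥤ Type u) : T.assoc P R S ≫ T.assocInv P R S = 𝟙 _ := by
  refine T.hom_ext₃ (T.obj_mem _ _) (fun x y z => ?_)
  simp only [NatTrans.comp_app_apply, T.assoc_app_pure, psh_app_map, T.assocInv_app_pure,
    psh_map_map, Iso.hom_inv_id, op_id, Functor.map_id_apply, psh_id_app]

theorem assocInv_assoc (P R S : Kᵒᵖ ⥤ Type u) : T.assocInv P R S ≫ T.assoc P R S = 𝟙 _ := by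
  refine T.hom_ext₃_right (T.obj_mem _ _) (fun x y z => ?_)
  simp only [NatTrans.comp_app_apply, T.assoc_app_pure, psh_app_map, T.assocInv_app_pure,
    psh_map_map, Iso.inv_hom_id, op_id, Functor.map_id_apply, psh_id_app]

/-- The inverse of the left unitor. -/
def leftUnitorInv (P : Kᵒᵖ ⥤ Type u) : P ⟶ T.obj (yoneda.obj (𝟙_ K)) P where
  app a := ↾(fun y => (T.obj (yoneda.obj (𝟙_ K)) P).map (λ_ a.unop).inv.op
    (T.pure (P := yoneda.obj (𝟙_ K)) (a := 𝟙_ K) (𝟙 (𝟙_ K)) y))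
  naturality a a' s := by
    ext y
    refine (congrArg _ (T.pure_map_right s.unop _ y)).trans ?_
    refine (psh_map_map _ _ _ _).trans (Eq.trans ?_ (psh_map_map _ s.unop _ _).symm)
    rw [leftUnitor_inv_naturality]

/-- The inverse of the right unitor. -/
def rightUnitorInv (P : Kᵒᵖ ⥤ Type u) : P ⟶ T.obj P (yoneda.obj (𝟙_ K)) where
  app a := ↾(fun x => (T.obj P (yoneda.obj (𝟙_ K))).map (ρ_ a.unop).inv.op
    (T.pure (R := yoneda.obj (𝟙_ K)) (b := 𝟙_ K) x (𝟙 (𝟙_ K))))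
  naturality a a' s := by
    ext y
    refine (congrArg _ (T.pure_map_left s.unop y _)).trans ?_
    refine (psh_map_map _ _ _ _).trans (Eq.trans ?_ (psh_map_map _ s.unop _ _).symm)
    rw [rightUnitor_inv_naturality]

theorem leftUnitorInv_leftUnitor (hP : T.mem P) :
    T.leftUnitorInv P ≫ T.leftUnitor hP = 𝟙 P := by
  ext ⟨a⟩ y
  refine (psh_app_map (T.leftUnitor hP) (λ_ a).inv _).trans ?_
  rw [T.leftUnitor_app_pure hP, psh_map_map, id_whiskerRight, Category.id_comp, Iso.inv_hom_id]
  exact ConcreteCategory.congr_hom (P.map_id (op a)) y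

theorem rightUnitorInv_rightUnitor (hP : T.mem P) :
    T.rightUnitorInv P ≫ T.rightUnitor hP = 𝟙 P := by
  ext ⟨a⟩ x
  refine (psh_app_map (T.rightUnitor hP) (ρ_ a).inv _).trans ?_
  rw [T.rightUnitor_app_pure hP, psh_map_map, whiskerLeft_id, Category.id_comp, Iso.inv_hom_id]
  exact ConcreteCategory.congr_hom (P.map_id (op a)) x

theorem leftUnitor_leftUnitorInv (hP : T.mem P) :
    T.leftUnitor hP ≫ T.leftUnitorInv P = 𝟙 (T.obj (yoneda.obj (𝟙_ K)) P) := by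
  refine T.hom_ext (T.obj_mem _ _) (fun {a b} (i : a ⟶ 𝟙_ K) y => ?_)
  refine (congrArg (fun w => (T.leftUnitorInv P).app _ w) (T.leftUnitor_app_pure hP i y)).trans ?_
  refine (psh_app_map (T.leftUnitorInv P) _ y).trans ?_
  refine (psh_map_map _ _ _ _).trans ?_
  have e : (i ▷ b ≫ (λ_ b).hom) ≫ (λ_ b).inv = i ▷ b := by simp
  refine (congrArg (fun k => (T.obj (yoneda.obj (𝟙_ K)) P).map (Quiver.Hom.op k) _) e).trans ?_
  -- As in the Yoneda lemma, `i` is the restriction of the identity of `I` along `i`, so the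
  -- whiskering by `i` is absorbed into the first factor.
  refine (T.pure_map_left (P := yoneda.obj (𝟙_ K)) i (𝟙 (𝟙_ K)) y).symm.trans ?_
  exact congrArg (fun k => T.pure (P := yoneda.obj (𝟙_ K)) k y) (Category.comp_id i)

theorem rightUnitor_rightUnitorInv (hP : T.mem P) :
    T.rightUnitor hP ≫ T.rightUnitorInv P = 𝟙 (T.obj P (yoneda.obj (𝟙_ K))) := by
  refine T.hom_ext (T.obj_mem _ _) (fun {a b} x (i : b ⟶ 𝟙_ K) => ?_)
  refine (congrArg (fun w => (T.rightUnitorInv P).app _ w) (T.rightUnitor_app_pure hP x i)).trans ?_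
  refine (psh_app_map (T.rightUnitorInv P) _ x).trans ?_
  refine (psh_map_map _ _ _ _).trans ?_
  have e : (a ◁ i ≫ (ρ_ a).hom) ≫ (ρ_ a).inv = a ◁ i := by simp
  refine (congrArg (fun k => (T.obj P (yoneda.obj (𝟙_ K))).map (Quiver.Hom.op k) _) e).trans ?_
  refine (T.pure_map_right (R := yoneda.obj (𝟙_ K)) i x (𝟙 (𝟙_ K))).symm.trans ?_
  exact congrArg (fun k => T.pure (R := yoneda.obj (𝟙_ K)) x k) (Category.comp_id i)

end PshMonoidal

/-! ### Day convolution as a tensor product generated by pure tensors. -/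

section

variable {K : Type u} [Category.{u} K] [MonoidalCategory K] {P P' R R' S Z : Kᵒᵖ ⥤ Type u}

/-- The pure tensor `x ⊗ y` in the Day convolution. -/
def DayObj.pure {a b : K} (x : P.obj (op a)) (y : R.obj (op b)) :
    (day P R).obj (op (a ⊗ b)) := DayObj.mk (𝟙 (a ⊗ b)) x y

theorem DayObj.map_pure {a a' b b' : K} (s : a ⟶ a') (t : b ⟶ b') (x : P.obj (op a'))
    (y : R.obj (op b')) :
    (day P R).map (s ⊗ₘ t).op (DayObj.pure x y) = DayObj.pure (P.map s.op x) (R.map t.op y) := by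
  refine Eq.trans ?_ (DayObj.glide (𝟙 (a ⊗ b)) s t x y)
  exact congrArg (fun k => DayObj.mk k x y) ((Category.comp_id _).trans (Category.id_comp _).symm)

/-- This is why pure tensors suffice: every element of the coend is a restriction of one, hence a
natural map is determined by its values on them. -/
theorem DayObj.mk_eq_map_pure {a b c : K} (f : c ⟶ a ⊗ b) (x : P.obj (op a))
    (y : R.obj (op b)) : DayObj.mk f x y = (day P R).map f.op (DayObj.pure x y) :=
  congrArg (fun k => DayObj.mk k x y) (Category.comp_id f).symm

theorem day.hom_ext {f g : day P R ⟶ Z}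
    (h : ∀ {a b : K} (x : P.obj (op a)) (y : R.obj (op b)),
      f.app (op (a ⊗ b)) (DayObj.pure x y) = g.app (op (a ⊗ b)) (DayObj.pure x y)) : f = g := by
  ext c q
  induction q using DayObj.ind with
  | h k x y =>
    rw [DayObj.mk_eq_map_pure]
    refine (psh_app_map f k _).trans (Eq.trans ?_ (psh_app_map g k _).symm)
    exact congrArg _ (h x y)

theorem day.map_app_pure (m : P ⟶ P') (n : R ⟶ R') {a b : K} (x : P.obj (op a))
    (y : R.obj (op b)) :
    (day.map m n).app (op (a ⊗ b)) (DayObj.pure x y) =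
      DayObj.pure (m.app (op a) x) (n.app (op b) y) := rfl

theorem day.assoc_app_pure {a b c : K} (x : P.obj (op a)) (y : R.obj (op b)) (z : S.obj (op c)) :
    (day.assoc P R S).app (op ((a ⊗ b) ⊗ c)) (DayObj.pure (DayObj.pure x y) z) =
      (day P (day R S)).map (α_ a b c).hom.op (DayObj.pure x (DayObj.pure y z)) := by
  refine congrArg (fun k => DayObj.mk (P := P) (R := day R S) k x (DayObj.mk (𝟙 _) y z)) ?_
  simp

theorem day.leftUnitor_app_pure {a b : K} (i : a ⟶ 𝟙_ K) (y : P.obj (op b)) :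
    (day.leftUnitor P).app (op (a ⊗ b)) (DayObj.pure (P := yoneda.obj (𝟙_ K)) i y) =
      P.map (i ▷ b ≫ (λ_ b).hom).op y :=
  congrArg (fun k => P.map (Quiver.Hom.op k) y) (Category.id_comp _)

theorem day.rightUnitor_app_pure {a b : K} (x : P.obj (op a)) (i : b ⟶ 𝟙_ K) :
    (day.rightUnitor P).app (op (a ⊗ b)) (DayObj.pure (R := yoneda.obj (𝟙_ K)) x i) =
      P.map (a ◁ i ≫ (ρ_ a).hom).op x :=
  congrArg (fun k => P.map (Quiver.Hom.op k) x) (Category.id_comp _)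

theorem day.braiding_app_pure [BraidedCategory K] {a b : K} (x : P.obj (op a))
    (y : R.obj (op b)) :
    (day.braiding P R).app (op (a ⊗ b)) (DayObj.pure x y) =
      (day R P).map (β_ a b).hom.op (DayObj.pure y x) :=
  congrArg (fun k => DayObj.mk k y x) ((Category.id_comp _).trans (Category.comp_id _).symm)

variable (K) in
/-- The Day convolution of all presheaves. -/
def dayMonoidal [SymmetricCategory K] : PshMonoidal K where
  -- No condition on targets is needed, since the elements of the coend are themselves restrictions
  -- of pure tensors.
  mem := ⊤
  mem_shiftRight _ _ := trivial
  mem_shiftLeft _ _ := trivial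
  obj := day
  obj_mem _ _ := trivial
  pure := DayObj.pure
  map_pure := DayObj.map_pure
  hom_ext {_ _ _} _ {_ _} h := day.hom_ext h
  map := day.map
  assoc := day.assoc
  leftUnitor _ := day.leftUnitor _
  rightUnitor _ := day.rightUnitor _
  braiding := day.braiding
  map_app_pure := day.map_app_pure
  assoc_app_pure := day.assoc_app_pure
  leftUnitor_app_pure _ := day.leftUnitor_app_pure
  rightUnitor_app_pure _ := day.rightUnitor_app_pure
  braiding_app_pure := day.braiding_app_pure

end

/-! ### Reflected Day convolution of presheaves on `Q`. -/

section

variable {Q : Type u} [Category.{u} Q] {P P' R R' S Z : Qᵒᵖ ⥤ Type u}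

/-- Transposition along the adjunction is precomposition with the unit, and it is injective. This is
the uniqueness that complements `reflLift₀_fac`. -/
theorem refl_hom_ext (hZ : prodPreserving Q Z) {f g : refl₀.obj P ⟶ Z}
    (h : reflUnit₀ P ≫ f = reflUnit₀ P ≫ g) : f = g := by
  have e : (reflectorAdj.homEquiv P ⟨Z, hZ⟩) (ObjectProperty.homMk f) =
      (reflectorAdj.homEquiv P ⟨Z, hZ⟩) (ObjectProperty.homMk g) := by
    rw [Adjunction.homEquiv_unit, Adjunction.homEquiv_unit]
    exact h
  exact congrArg (fun k => (prodPreserving Q).ι.map k) ((reflectorAdj.homEquiv P ⟨Z, hZ⟩).injective e)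

theorem refl_map_app_unit (m : P ⟶ R) {a : Qᵒᵖ} (x : P.obj a) :
    (refl₀.map m).app a ((reflUnit₀ P).app a x) = (reflUnit₀ R).app a (m.app a x) :=
  (ConcreteCategory.congr_hom (NatTrans.congr_app (reflectorAdj.unit.naturality m) a) x).symm

theorem reflLift₀_app_unit (hZ : prodPreserving Q Z) (m : P ⟶ Z) {a : Qᵒᵖ} (x : P.obj a) :
    (reflLift₀ hZ m).app a ((reflUnit₀ P).app a x) = m.app a x :=
  ConcreteCategory.congr_hom (NatTrans.congr_app (reflLift₀_fac hZ m) a) x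

theorem refl_prodPreserving (P : Qᵒᵖ ⥤ Type u) : prodPreserving Q (refl₀.obj P) :=
  (reflector.obj P).property

variable [MonoidalCategory Q]

/-- Distributivity enters here: `- ⊗ b` preserves the binary coproducts that exist in `Q`, so its
opposite preserves products, and hence so does the composite with `Z`. -/
theorem prodPreserving_shiftRight (b : Q)
    [PreservesColimitsOfShape (Discrete WalkingPair) (tensorRight b)]
    (hZ : prodPreserving Q Z) : prodPreserving Q ((tensorRight b).op ⋙ Z) := by
  have : PreservesLimitsOfShape (Discrete WalkingPair) Z := hZ
  -- Limits of shape `J` in `Qᵒᵖ` are colimits of shape `Jᵒᵖ` in `Q`; a discrete category is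
  -- equivalent to its opposite.
  have : PreservesColimitsOfShape (Discrete WalkingPair)ᵒᵖ (tensorRight b) :=
    preservesColimitsOfShape_of_equiv (Discrete.opposite WalkingPair).symm _
  have : PreservesLimitsOfShape (Discrete WalkingPair) (tensorRight b).op :=
    preservesLimitsOfShape_op _ _
  exact inferInstanceAs
    (PreservesLimitsOfShape (Discrete WalkingPair) ((tensorRight b).op ⋙ Z))

/-- Distributivity is assumed on one side only; the braiding identifies `a ⊗ -` with `- ⊗ a`. -/
theorem prodPreserving_shiftLeft [BraidedCategory Q] (a : Q)
    [PreservesColimitsOfShape (Discrete WalkingPair) (tensorRight a)]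
    (hZ : prodPreserving Q Z) : prodPreserving Q ((tensorLeft a).op ⋙ Z) :=
  (prodPreserving Q).prop_of_iso
    (Functor.isoWhiskerRight (NatIso.op (BraidedCategory.tensorLeftIsoTensorRight a)) Z)
    (prodPreserving_shiftRight a hZ)

variable [∀ X : Q, PreservesColimitsOfShape (Discrete WalkingPair) (tensorRight X)]

theorem dayExtend_app_pure (hZ : prodPreserving Q Z) (g : day P S ⟶ Z) {a b : Q}
    (x : P.obj (op a)) (y : S.obj (op b)) :
    (dayExtend hZ g).app (op (a ⊗ b)) (DayObj.pure ((reflUnit₀ P).app (op a) x) y) =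
      g.app (op (a ⊗ b)) (DayObj.pure x y) :=
  ConcreteCategory.congr_hom (NatTrans.congr_app (dayExtend_fac hZ g) (op (a ⊗ b)))
    (DayObj.pure x y)

variable (Q) in
/-- The reflected Day convolution of product preserving presheaves. -/
noncomputable def reflMonoidal [SymmetricCategory Q] : PshMonoidal Q where
  mem := prodPreserving Q
  mem_shiftRight b h := prodPreserving_shiftRight b h
  mem_shiftLeft a h := prodPreserving_shiftLeft a h
  obj P R := refl₀.obj (day P R)
  obj_mem P R := refl_prodPreserving _
  pure {P R a b} x y := (reflUnit₀ (day P R)).app (op (a ⊗ b)) (DayObj.pure x y)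
  map_pure s t x y := by rw [← psh_app_map, DayObj.map_pure]
  -- Generation survives the reflection: a map to a product preserving presheaf is determined by its
  -- restriction along the unit, which is a map out of the Day convolution.
  hom_ext {_ _ _} hZ {_ _} h := refl_hom_ext hZ (day.hom_ext h)
  map m n := refl₀.map (day.map m n)
  -- Two reflections have to be removed from the source: `dayExtend` deals with the inner one by
  -- currying, `reflLift₀` with the outer one. The expression is level 0 of the associator of
  -- `lamTensor`, so that `level₀_assoc` holds by definition.
  assoc P R S := reflLift₀ (refl_prodPreserving _) (dayExtend (refl_prodPreserving _)
    ((day.assoc P R S ≫ day.map (𝟙 P) (reflUnit₀ (day R S))) ≫ reflUnit₀ _))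
  leftUnitor {P} hP := refl₀.map (day.leftUnitor P) ≫ reflLift₀ hP (𝟙 P)
  rightUnitor {P} hP := refl₀.map (day.rightUnitor P) ≫ reflLift₀ hP (𝟙 P)
  braiding P R := refl₀.map (day.braiding P R)
  map_app_pure {_ _ _ _} m n {_ _} x y := by rw [refl_map_app_unit, day.map_app_pure]
  assoc_app_pure x y z := by
    rw [reflLift₀_app_unit, dayExtend_app_pure, NatTrans.comp_app_apply, NatTrans.comp_app_apply,
      day.assoc_app_pure, psh_app_map, psh_app_map, day.map_app_pure, psh_id_app]
  leftUnitor_app_pure {_} hP {_ _} i y := by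
    rw [NatTrans.comp_app_apply, refl_map_app_unit, reflLift₀_app_unit, day.leftUnitor_app_pure,
      psh_id_app]
  rightUnitor_app_pure {_} hP {_ _} x i := by
    rw [NatTrans.comp_app_apply, refl_map_app_unit, reflLift₀_app_unit, day.rightUnitor_app_pure,
      psh_id_app]
  braiding_app_pure x y := by
    rw [refl_map_app_unit, day.braiding_app_pure, psh_app_map]

end

/-! ### Maps of `C̃` and their two levels. -/

namespace Interpretation

variable {Q : Type u} [Category.{u} Q] [MonoidalCategory Q] [SymmetricCategory Q]
  {𝓜 : Interpretation Q}

theorem Psh.nat₀_injective {F G : 𝓜.Psh} {β γ : Nat₀ F G} (h : Psh.nat₀ β = Psh.nat₀ γ) :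
    β = γ :=
  Nat₀.ext (funext fun X => funext fun x =>
    ConcreteCategory.congr_hom (NatTrans.congr_app h (op X.unop.ob)) x)

theorem Psh.nat₁_ext {F G : 𝓜.Psh} {α α' : Nat₁ F G} (h₀ : α.toNat₀ = α'.toNat₀)
    (h₁ : Psh.nat₁ α = Psh.nat₁ α') : α = α' :=
  Nat₁.ext (funext fun X => Biset.hom_ext
    (fun x => congrFun (congrFun (congrArg Nat₀.app h₀) X) x)
    (fun x => ConcreteCategory.congr_hom (NatTrans.congr_app h₁ X) x))

/-- Maps of bisets to a hom-object of `C̄` are determined by the natural transformations at the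
levels `0` and `1` that they give rise to. -/
theorem Psh.hom_ext {A : Biset.{u}} {F G : 𝓜.Psh} {φ ψ : A ⟶ (F ⟶[Biset.{u}] G)}
    (h₀ : ∀ a : A.zero, Psh.nat₀ (Biset.Hom.zero φ a) = Psh.nat₀ (Biset.Hom.zero ψ a))
    (h₁ : ∀ a : A.one, Psh.nat₁ (F := F) (G := G) (Biset.Hom.one φ a) =
      Psh.nat₁ (F := F) (G := G) (Biset.Hom.one ψ a)) : φ = ψ := by
  have e : ∀ a, Biset.Hom.zero φ a = Biset.Hom.zero ψ a := fun a => Psh.nat₀_injective (h₀ a)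
  refine Biset.hom_ext e (fun a => Psh.nat₁_ext ?_ (h₁ a))
  -- An element of `F ⇒₁ G` also has a level 0 part. It is the value of the map at the image of `a`
  -- in `A.zero`, so `h₀` covers it.
  exact (Biset.Hom.comm φ a).trans ((e _).trans (Biset.Hom.comm ψ a).symm)

/-- Level `0` of a map in `C̃`. -/
def level₀ {F G : 𝓜.Smooth} (f : EMap Biset.{u} F G) : F.obj.zero ⟶ G.obj.zero :=
  Psh.nat₀ (Biset.Hom.zero f PUnit.unit)

/-- Level `1` of a map in `C̃`. -/
def level₁ {F G : 𝓜.Smooth} (f : EMap Biset.{u} F G) : F.obj.one ⟶ G.obj.one :=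
  Psh.nat₁ (F := F.obj) (G := G.obj) (Biset.Hom.one f PUnit.unit)

theorem level_ext {F G : 𝓜.Smooth} {f g : EMap Biset.{u} F G} (h₀ : level₀ f = level₀ g)
    (h₁ : level₁ f = level₁ g) : f = g :=
  Psh.hom_ext (fun _ => h₀) (fun _ => h₁)

theorem level_comm {F G : 𝓜.Smooth} (f : EMap Biset.{u} F G) :
    level₁ f ≫ G.obj.str = F.obj.str ≫ Functor.whiskerLeft 𝓜.functor.op (level₀ f) := by
  have e : Nat₁.toNat₀ (Biset.Hom.one f PUnit.unit) = Biset.Hom.zero f PUnit.unit :=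
    Biset.Hom.comm f PUnit.unit
  rw [level₀, ← e]
  exact Psh.nat_comm (F := F.obj) (G := G.obj) (Biset.Hom.one f PUnit.unit)

theorem level₀_comp {F G H : 𝓜.Smooth} (f : EMap Biset.{u} F G) (g : EMap Biset.{u} G H) :
    level₀ (f.comp g) = level₀ f ≫ level₀ g := rfl

theorem level₁_comp {F G H : 𝓜.Smooth} (f : EMap Biset.{u} F G) (g : EMap Biset.{u} G H) :
    level₁ (f.comp g) = level₁ f ≫ level₁ g := rfl

theorem level₀_id (F : 𝓜.Smooth) : level₀ (eId Biset.{u} F) = 𝟙 F.obj.zero := rfl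

theorem level₁_id (F : 𝓜.Smooth) : level₁ (eId Biset.{u} F) = 𝟙 F.obj.one := rfl

section

variable {A : Biset.{u}} {F G H : 𝓜.Smooth}

/-- This and the next three lemmas hold by definition. They open up the two sides of a naturality
square while the structure map stays folded as `level₀` or `level₁`, ready for rewriting. -/
theorem nat₀_post (φ : A ⟶ (F ⟶[Biset.{u}] G)) (g : EMap Biset.{u} G H) (p : A.zero) :
    Psh.nat₀ (F := F.obj) (G := H.obj) (Biset.Hom.zero (φ ≫ EMap.post F g) p) =
      Psh.nat₀ (F := F.obj) (G := G.obj) (Biset.Hom.zero φ p) ≫ level₀ g := rfl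

theorem nat₁_post (φ : A ⟶ (F ⟶[Biset.{u}] G)) (g : EMap Biset.{u} G H) (p : A.one) :
    Psh.nat₁ (F := F.obj) (G := H.obj) (Biset.Hom.one (φ ≫ EMap.post F g) p) =
      Psh.nat₁ (F := F.obj) (G := G.obj) (Biset.Hom.one φ p) ≫ level₁ g := rfl

theorem nat₀_pre (φ : A ⟶ (G ⟶[Biset.{u}] H)) (f : EMap Biset.{u} F G) (p : A.zero) :
    Psh.nat₀ (F := F.obj) (G := H.obj) (Biset.Hom.zero (φ ≫ EMap.pre f H) p) =
      level₀ f ≫ Psh.nat₀ (F := G.obj) (G := H.obj) (Biset.Hom.zero φ p) := rfl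

theorem nat₁_pre (φ : A ⟶ (G ⟶[Biset.{u}] H)) (f : EMap Biset.{u} F G) (p : A.one) :
    Psh.nat₁ (F := F.obj) (G := H.obj) (Biset.Hom.one (φ ≫ EMap.pre f H) p) =
      level₁ f ≫ Psh.nat₁ (F := G.obj) (G := H.obj) (Biset.Hom.one φ p) := rfl

end

/-- A map of `C̃` is invertible if it is so at both levels. -/
theorem isInvertible_of_levels {F G : 𝓜.Smooth} (f : EMap Biset.{u} F G)
    (g₀ : G.obj.zero ⟶ F.obj.zero) (g₁ : G.obj.one ⟶ F.obj.one)
    (h₀ : level₀ f ≫ g₀ = 𝟙 _) (h₀' : g₀ ≫ level₀ f = 𝟙 _) (h₁ : level₁ f ≫ g₁ = 𝟙 _)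
    (h₁' : g₁ ≫ level₁ f = 𝟙 _) : f.IsInvertible := by
  -- Compatibility of the inverses with the structure maps is automatic: it is the square of `f`
  -- with both vertical sides inverted.
  have h : g₁ ≫ F.obj.str = G.obj.str ≫ Functor.whiskerLeft 𝓜.functor.op g₀ := by
    calc g₁ ≫ F.obj.str
        = g₁ ≫ F.obj.str ≫ Functor.whiskerLeft 𝓜.functor.op (level₀ f ≫ g₀) := by
          rw [h₀, Functor.whiskerLeft_id']; exact congrArg _ (Category.comp_id _).symm
      _ = g₁ ≫ (level₁ f ≫ G.obj.str) ≫ Functor.whiskerLeft 𝓜.functor.op g₀ := by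
          rw [level_comm, Functor.whiskerLeft_comp, Category.assoc]
      _ = (g₁ ≫ level₁ f) ≫ G.obj.str ≫ Functor.whiskerLeft 𝓜.functor.op g₀ := by
          simp only [Category.assoc]
      _ = _ := by rw [h₁', Category.id_comp]
  exact ⟨Biset.point (X := G.obj ⟶[Biset.{u}] F.obj)
      (Psh.ofNat₁ (F := G.obj) (G := F.obj) g₀ g₁ h),
    level_ext h₀ h₁, level_ext h₀' h₁'⟩

variable [∀ X : Q, PreservesColimitsOfShape (Discrete WalkingPair) (tensorRight X)]
  (F G H : 𝓜.Smooth)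

theorem lamTensor_obj_zero : (𝓜.lamTensor.obj F G).obj.zero =
    (reflMonoidal Q).obj F.obj.zero G.obj.zero := rfl

theorem lamTensor_obj_one : (𝓜.lamTensor.obj F G).obj.one =
    (dayMonoidal 𝓜.Obj).obj F.obj.one G.obj.one := rfl

theorem level₀_assoc : level₀ (𝓜.lamTensor.assoc F G H) =
    (reflMonoidal Q).assoc F.obj.zero G.obj.zero H.obj.zero := rfl

/-- The units of the reflection are identities at level 1; once they are dropped, only the
associator of the Day convolution is left. -/
theorem level₁_assoc : level₁ (𝓜.lamTensor.assoc F G H) =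
    (dayMonoidal 𝓜.Obj).assoc F.obj.one G.obj.one H.obj.one := by
  have h : level₁ (𝓜.lamTensor.assoc F G H) =
    ((dayMonoidal 𝓜.Obj).assoc F.obj.one G.obj.one H.obj.one ≫
      (dayMonoidal 𝓜.Obj).map (𝟙 _) (𝟙 _)) ≫ 𝟙 _ := rfl
  rw [h, PshMonoidal.map_id, Category.comp_id, Category.comp_id]

theorem lamTensor_assoc_natural (F₁ F₂ F₃ G₁ G₂ G₃ : 𝓜.Smooth) :
    (𝓜.lamTensor.hom F₁ F₂ G₁ G₂ ▷ (F₃ ⟶[Biset.{u}] G₃)) ≫ 𝓜.lamTensor.hom _ F₃ _ G₃ ≫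
        EMap.post _ (𝓜.lamTensor.assoc G₁ G₂ G₃) =
      (α_ _ _ _).hom ≫ ((F₁ ⟶[Biset.{u}] G₁) ◁ 𝓜.lamTensor.hom F₂ F₃ G₂ G₃) ≫
        𝓜.lamTensor.hom F₁ _ G₁ _ ≫ EMap.pre (𝓜.lamTensor.assoc F₁ F₂ F₃) _ := by
  simp only [← Category.assoc]
  refine Psh.hom_ext (fun p => ?_) (fun p => ?_)
  · refine (nat₀_post _ _ p).trans (Eq.trans ?_ (nat₀_pre _ _ p).symm)
    rw [level₀_assoc, level₀_assoc]
    exact (reflMonoidal Q).assoc_natural (Psh.nat₀ p.1.1) (Psh.nat₀ p.1.2) (Psh.nat₀ p.2)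
  · refine (nat₁_post _ _ p).trans (Eq.trans ?_ (nat₁_pre _ _ p).symm)
    rw [level₁_assoc, level₁_assoc]
    exact (dayMonoidal 𝓜.Obj).assoc_natural (Psh.nat₁ p.1.1) (Psh.nat₁ p.1.2) (Psh.nat₁ p.2)

theorem level₀_braiding : level₀ (𝓜.lamTensor.braiding F G) =
    (reflMonoidal Q).braiding F.obj.zero G.obj.zero := rfl

theorem level₀_tensorMap {F G H K : 𝓜.Smooth} (f : EMap Biset.{u} F G)
    (g : EMap Biset.{u} H K) : level₀ (𝓜.lamTensor.tensorMap f g) =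
      (reflMonoidal Q).map (level₀ f) (level₀ g) := rfl

theorem level₁_tensorMap {F G H K : 𝓜.Smooth} (f : EMap Biset.{u} F G)
    (g : EMap Biset.{u} H K) : level₁ (𝓜.lamTensor.tensorMap f g) =
      (dayMonoidal 𝓜.Obj).map (level₁ f) (level₁ g) := rfl

end Interpretation

/-! ### The symmetric monoidal structure of `C̃`. -/

namespace Interpretation

variable {Q : Type u} [Category.{u} Q] [MonoidalCategory Q] [SymmetricCategory Q]
  {𝓜 : Interpretation Q}
  [∀ X : Q, PreservesColimitsOfShape (Discrete WalkingPair) (tensorRight X)]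

-- Each law splits into the same law for `reflMonoidal Q` at level 0 and for `dayMonoidal 𝓜.Obj` at
-- level 1. Smoothness of the given functors matters only for the unitors, whose level 0 ends in a
-- product preserving presheaf.
set_option maxHeartbeats 1000000 in
variable (𝓜) in
theorem lamTensor_isSymmetricMonoidal : 𝓜.lamTensor.IsSymmetricMonoidal where
  tensor_id F G := level_ext ((reflMonoidal Q).map_id _ _) ((dayMonoidal 𝓜.Obj).map_id _ _)
  tensor_comp F₁ F₂ G₁ G₂ H₁ H₂ := Psh.hom_ext
    (fun p => (reflMonoidal Q).map_comp (Psh.nat₀ p.1.1) (Psh.nat₀ p.2.1) (Psh.nat₀ p.1.2)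
      (Psh.nat₀ p.2.2))
    (fun p => (dayMonoidal 𝓜.Obj).map_comp (Psh.nat₁ p.1.1) (Psh.nat₁ p.2.1) (Psh.nat₁ p.1.2)
      (Psh.nat₁ p.2.2))
  assoc_natural := lamTensor_assoc_natural
  leftUnitor_natural F G := Psh.hom_ext
    (fun p => (reflMonoidal Q).leftUnitor_natural F.prop G.prop (Psh.nat₀ p))
    (fun p => (dayMonoidal 𝓜.Obj).leftUnitor_natural trivial trivial (Psh.nat₁ p))
  rightUnitor_natural F G := Psh.hom_ext
    (fun p => (reflMonoidal Q).rightUnitor_natural F.prop G.prop (Psh.nat₀ p))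
    (fun p => (dayMonoidal 𝓜.Obj).rightUnitor_natural trivial trivial (Psh.nat₁ p))
  braiding_natural F₁ F₂ G₁ G₂ := Psh.hom_ext
    (fun p => (reflMonoidal Q).braiding_natural (Psh.nat₀ p.1) (Psh.nat₀ p.2))
    (fun p => (dayMonoidal 𝓜.Obj).braiding_natural (Psh.nat₁ p.1) (Psh.nat₁ p.2))
  assoc_invertible F G H := isInvertible_of_levels _ ((reflMonoidal Q).assocInv F.obj.zero G.obj.zero H.obj.zero)
    ((dayMonoidal 𝓜.Obj).assocInv F.obj.one G.obj.one H.obj.one) (by rw [level₀_assoc]; exact (reflMonoidal Q).assoc_assocInv F.obj.zero G.obj.zero H.obj.zero)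
    (by rw [level₀_assoc]; exact (reflMonoidal Q).assocInv_assoc F.obj.zero G.obj.zero H.obj.zero)
    (by rw [level₁_assoc]; exact (dayMonoidal 𝓜.Obj).assoc_assocInv F.obj.one G.obj.one H.obj.one)
    (by rw [level₁_assoc]; exact (dayMonoidal 𝓜.Obj).assocInv_assoc F.obj.one G.obj.one H.obj.one)
  leftUnitor_invertible F := isInvertible_of_levels _ ((reflMonoidal Q).leftUnitorInv _)
    ((dayMonoidal 𝓜.Obj).leftUnitorInv _) ((reflMonoidal Q).leftUnitor_leftUnitorInv _)
    ((reflMonoidal Q).leftUnitorInv_leftUnitor _)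
    ((dayMonoidal 𝓜.Obj).leftUnitor_leftUnitorInv trivial)
    ((dayMonoidal 𝓜.Obj).leftUnitorInv_leftUnitor trivial)
  rightUnitor_invertible F := isInvertible_of_levels _ ((reflMonoidal Q).rightUnitorInv _)
    ((dayMonoidal 𝓜.Obj).rightUnitorInv _) ((reflMonoidal Q).rightUnitor_rightUnitorInv _)
    ((reflMonoidal Q).rightUnitorInv_rightUnitor _)
    ((dayMonoidal 𝓜.Obj).rightUnitor_rightUnitorInv trivial)
    ((dayMonoidal 𝓜.Obj).rightUnitorInv_rightUnitor trivial)
  symmetry F G := level_ext ((reflMonoidal Q).symmetry _ _) ((dayMonoidal 𝓜.Obj).symmetry _ _)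
  pentagon F G H K := level_ext (by
    simp only [level₀_comp, level₀_tensorMap, level₀_assoc, level₀_id]
    dsimp only [lamTensor_obj_zero]
    exact (reflMonoidal Q).pentagon F.obj.zero G.obj.zero H.obj.zero K.obj.zero) (by
    simp only [level₁_comp, level₁_tensorMap, level₁_assoc, level₁_id]
    dsimp only [lamTensor_obj_one]
    exact (dayMonoidal 𝓜.Obj).pentagon F.obj.one G.obj.one H.obj.one K.obj.one)
  triangle F G := level_ext (by
    simp only [level₀_comp, level₀_tensorMap, level₀_assoc, level₀_id]
    dsimp only [lamTensor_obj_zero]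
    exact (reflMonoidal Q).triangle F.prop G.prop) (by
    simp only [level₁_comp, level₁_tensorMap, level₁_assoc, level₁_id]
    dsimp only [lamTensor_obj_one]
    exact (dayMonoidal 𝓜.Obj).triangle trivial trivial)
  hexagon F G H := level_ext (by
    simp only [level₀_comp, level₀_tensorMap, level₀_assoc, level₀_id]
    dsimp only [lamTensor_obj_zero]
    exact (reflMonoidal Q).hexagon F.obj.zero G.obj.zero H.obj.zero) (by
    simp only [level₁_comp, level₁_tensorMap, level₁_assoc, level₁_id]
    dsimp only [lamTensor_obj_one]
    exact (dayMonoidal 𝓜.Obj).hexagon F.obj.one G.obj.one H.obj.one)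

end Interpretation

/-! ### The monad `T̃` and the values of its strength on pure tensors. -/

namespace Interpretation

variable {Q : Type u} [Category.{u} Q] [MonoidalCategory Q] [SymmetricCategory Q]
  {𝓜 : Interpretation Q}

theorem level₀_image {F G : 𝓜.Smooth} (f : EMap Biset.{u} F G) :
    level₀ (f.image 𝓜.Ttilde) = level₀ f := rfl

/-- Since `(T̃ F)¹ = F⁰ ∘ J`, the level 1 part of `T̃ f` is computed from the level 0 part of `f`.
-/
theorem level₁_image_app {F G : 𝓜.Smooth} (f : EMap Biset.{u} F G) (X : 𝓜.Objᵒᵖ)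
    (x : F.obj.zero.obj (op X.unop.ob)) :
    (level₁ (f.image 𝓜.Ttilde)).app X x = (level₀ f).app (op X.unop.ob) x := by
  have e : Nat₁.toNat₀ (Biset.Hom.one f PUnit.unit) = Biset.Hom.zero f PUnit.unit :=
    Biset.Hom.comm f PUnit.unit
  rw [level₀, ← e]
  rfl

theorem level₀_etaTilde (F : 𝓜.Smooth) : level₀ (𝓜.etaTilde F) = 𝟙 F.obj.zero := rfl

theorem level₀_muTilde (F : 𝓜.Smooth) : level₀ (𝓜.muTilde F) = 𝟙 F.obj.zero := rfl

-- All structure maps are identities at level 0, and `μ` is one at level 1 too. The only law with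
-- content is naturality of `η` at level 1, where `η` is the structure map of `F`: it says that maps
-- commute with structure maps.
variable (𝓜) in
theorem Ttilde_isVMonad : IsVMonad 𝓜.Ttilde 𝓜.etaTilde 𝓜.muTilde where
  unit_natural F G := Psh.hom_ext (fun p => rfl) (fun p => by
    ext X x
    exact Biset.Hom.comm (Nat₁.app p X) x)
  mul_natural F G := Psh.hom_ext (fun p => rfl) (fun p => rfl)
  assoc F := level_ext rfl rfl
  left_unit F := level_ext rfl rfl
  right_unit F := level_ext rfl rfl

variable [∀ X : Q, PreservesColimitsOfShape (Discrete WalkingPair) (tensorRight X)]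
  (F G H : 𝓜.Smooth)

/-- A pure tensor is the generator with identity arrow, and `J` preserves identities. So the
structure map of `F ⊗ G` acts factor by factor. -/
theorem lamTensor_str_app_pure {a b : 𝓜.Obj} (x : F.obj.one.obj (op a)) (y : G.obj.one.obj (op b)) :
    (𝓜.lamTensor.obj F G).obj.str.app (op (a ⊗ b)) ((dayMonoidal 𝓜.Obj).pure x y) =
      (reflMonoidal Q).pure (F.obj.str.app (op a) x) (G.obj.str.app (op b) y) :=
  congrArg (fun k => (reflUnit₀ (day F.obj.zero G.obj.zero)).app (op (a.ob ⊗ b.ob))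
    (DayObj.mk (P := F.obj.zero) (R := G.obj.zero) (c := a.ob ⊗ b.ob) (a := a.ob) (b := b.ob)
      k (F.obj.str.app (op a) x) (G.obj.str.app (op b) y))) (𝓜.functor.map_id (a ⊗ b))

/-- At level 0 both `β` and `t̄` are identities, and `ρ` becomes `ε ∘ L η`, which is the identity by
a triangle identity of the reflection. -/
theorem level₀_tTilde : level₀ (𝓜.tTilde F G) = 𝟙 ((reflMonoidal Q).obj F.obj.zero G.obj.zero) := by
  have h : level₀ (𝓜.tTilde F G) =
      ((reflMonoidal Q).map (𝟙 F.obj.zero) (𝟙 G.obj.zero) ≫ refl₀.map (𝟙 _)) ≫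
        (refl₀.map (reflUnit₀ _) ≫ refl₀.map (𝟙 _)) ≫
          reflLift₀ (refl_prodPreserving _) (𝟙 _) := rfl
  rw [h]
  refine (reflMonoidal Q).hom_ext (refl_prodPreserving _) (fun {a b} x y => ?_)
  rw [PshMonoidal.map_id, CategoryTheory.Functor.map_id, CategoryTheory.Functor.map_id]
  refine (congrArg (fun w => (reflLift₀ (refl_prodPreserving _) (𝟙 _)).app _ w)
    (refl_map_app_unit (reflUnit₀ (day F.obj.zero G.obj.zero)) (DayObj.pure x y))).trans ?_
  exact reflLift₀_app_unit (refl_prodPreserving _) (𝟙 _) _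

/-- At level 1, `t̄` is the structure map of `F ⊗ T̄ G`. It applies `φ` to `x` and leaves `y` alone,
because the structure map of `T̄ G` is the identity. Then `ρ` contributes the unit of the
reflection. -/
theorem level₁_tTilde_app_pure {a b : 𝓜.Obj} (x : F.obj.one.obj (op a))
    (y : G.obj.zero.obj (op b.ob)) :
    (level₁ (𝓜.tTilde F G)).app (op (a ⊗ b))
        ((dayMonoidal 𝓜.Obj).pure (R := (𝓜.Ttilde.obj G).obj.one) x y) =
      (reflMonoidal Q).pure (F.obj.str.app (op a) x) y :=
  congrArg (fun k => (reflUnit₀ (day F.obj.zero G.obj.zero)).app (op (a.ob ⊗ b.ob))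
    (DayObj.mk (P := F.obj.zero) (R := G.obj.zero) (c := a.ob ⊗ b.ob) (a := a.ob) (b := b.ob)
      k (F.obj.str.app (op a) x) y)) (𝓜.functor.map_id (a ⊗ b))

end Interpretation

/-! ### The laws of the strength, and commutativity. -/

namespace Interpretation

variable {Q : Type u} [Category.{u} Q] [MonoidalCategory Q] [SymmetricCategory Q]
  {𝓜 : Interpretation Q}

theorem Ttilde_obj_zero (F : 𝓜.Smooth) : (𝓜.Ttilde.obj F).obj.zero = F.obj.zero := rfl

theorem Ttilde_obj_one_map (F : 𝓜.Smooth) {a b : 𝓜.Obj} (f : a ⟶ b)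
    (x : F.obj.zero.obj (op b.ob)) :
    (𝓜.Ttilde.obj F).obj.one.map f.op x = F.obj.zero.map (𝓜.functor.map f).op x :=
  congrFun (φ_map F.obj (X := op b) (Y := op a) f) x

variable [∀ X : Q, PreservesColimitsOfShape (Discrete WalkingPair) (tensorRight X)]
  (F G H : 𝓜.Smooth)

/-- The parameter `k` allows `J f` to be supplied as a structural arrow of `Q`: the associator in
`tTilde_assoc`, the braiding in `level₁_sTilde_app_pure`. -/
theorem level₁_tTilde_map_pure {a b c : 𝓜.Obj} (f : c ⟶ a ⊗ b) (x : F.obj.one.obj (op a))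
    (y : G.obj.zero.obj (op b.ob)) {k : c.ob ⟶ a.ob ⊗ b.ob} (hk : 𝓜.functor.map f = k) :
    (level₁ (𝓜.tTilde F G)).app (op c) (((dayMonoidal 𝓜.Obj).obj F.obj.one
        (𝓜.Ttilde.obj G).obj.one).map f.op
          ((dayMonoidal 𝓜.Obj).pure (R := (𝓜.Ttilde.obj G).obj.one) x y)) =
      ((reflMonoidal Q).obj F.obj.zero G.obj.zero).map k.op
        ((reflMonoidal Q).pure (F.obj.str.app (op a) x) y) := by
  subst hk
  refine (psh_app_map (level₁ (𝓜.tTilde F G)) f _).trans ?_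
  refine (Ttilde_obj_one_map (𝓜.lamTensor.obj F G) f _).trans ?_
  exact congrArg (fun w => ((reflMonoidal Q).obj F.obj.zero G.obj.zero).map
    (𝓜.functor.map f).op w) (level₁_tTilde_app_pure F G x y)

theorem tTilde_natural (F₁ F₂ G₁ G₂ : 𝓜.Smooth) :
    ((F₁ ⟶[Biset.{u}] G₁) ◁ 𝓜.Ttilde.map F₂ G₂) ≫
        𝓜.lamTensor.hom F₁ (𝓜.Ttilde.obj F₂) G₁ (𝓜.Ttilde.obj G₂) ≫
          EMap.post _ (𝓜.tTilde G₁ G₂) =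
      𝓜.lamTensor.hom F₁ F₂ G₁ G₂ ≫ 𝓜.Ttilde.map _ _ ≫ EMap.pre (𝓜.tTilde F₁ F₂) _ := by
  simp only [← Category.assoc]
  refine Psh.hom_ext (fun p => ?_) (fun p => ?_)
  · refine (nat₀_post _ _ p).trans (Eq.trans ?_ (nat₀_pre _ _ p).symm)
    rw [level₀_tTilde, level₀_tTilde]
    exact (Category.comp_id _).trans (Category.id_comp _).symm
  · refine (nat₁_post _ _ p).trans (Eq.trans ?_ (nat₁_pre _ _ p).symm)
    refine (dayMonoidal 𝓜.Obj).hom_ext trivial (fun {a b} x y => ?_)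
    refine (level₁_tTilde_app_pure G₁ G₂ ((Psh.nat₁ p.1).app (op a) x)
      ((Psh.nat₀ (Nat₁.toNat₀ p.2)).app (op b.ob) y)).trans (Eq.trans ?_
      (congrArg (fun w => ((reflMonoidal Q).map (Psh.nat₀ (Nat₁.toNat₀ p.1))
        (Psh.nat₀ (Nat₁.toNat₀ p.2))).app (op (a.ob ⊗ b.ob)) w)
        (level₁_tTilde_app_pure F₁ F₂ x y)).symm)
    refine Eq.trans ?_ ((reflMonoidal Q).map_app_pure _ _ _ _).symm
    -- The two sides differ only in whether `φ` is applied after or before the map `F₁ → G₁`.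
    exact congrArg (fun w => (reflMonoidal Q).pure w _) (Biset.Hom.comm (Nat₁.app p.1 (op a)) x)

/-- At level 1, `η` applies `φ` to the second factor and `t̃` to the first, which together give the
structure map of `F ⊗ G`. -/
theorem tTilde_unit : (𝓜.lamTensor.tensorMap (eId Biset.{u} F) (𝓜.etaTilde G)).comp
    (𝓜.tTilde F G) = 𝓜.etaTilde (𝓜.lamTensor.obj F G) := by
  refine level_ext ?_ ?_
  · rw [level₀_comp, level₀_tensorMap, level₀_tTilde, level₀_id, level₀_etaTilde, level₀_etaTilde]
    dsimp only [lamTensor_obj_zero]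
    exact (Category.comp_id _).trans ((reflMonoidal Q).map_id F.obj.zero G.obj.zero)
  · refine (dayMonoidal 𝓜.Obj).hom_ext trivial (fun {a b} x y => ?_)
    exact (level₁_tTilde_app_pure F G x (G.obj.str.app (op b) y)).trans
      (lamTensor_str_app_pure F G x y).symm

/-- The strength under `T̃` enters level 1 only through its level 0, which is the identity. Both
sides therefore send `x ⊗ y` to `φ x ⊗ y`. -/
theorem tTilde_mul : ((𝓜.tTilde F (𝓜.Ttilde.obj G)).comp ((𝓜.tTilde F G).image 𝓜.Ttilde)).comp
      (𝓜.muTilde (𝓜.lamTensor.obj F G)) =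
    (𝓜.lamTensor.tensorMap (eId Biset.{u} F) (𝓜.muTilde G)).comp (𝓜.tTilde F G) := by
  refine level_ext ?_ ?_
  · simp only [level₀_comp, level₀_tensorMap, level₀_tTilde, level₀_id, level₀_muTilde,
      level₀_image]
    refine Eq.trans ?_ (congrArg (fun k => k ≫ 𝟙 _)
      ((reflMonoidal Q).map_id F.obj.zero G.obj.zero)).symm
    exact Category.comp_id _
  · refine (dayMonoidal 𝓜.Obj).hom_ext trivial (fun {a b} x y => ?_)
    refine Eq.trans ?_ (level₁_tTilde_app_pure F G x y).symm
    refine (level₁_image_app (𝓜.tTilde F G) (op (a ⊗ b)) _).trans ?_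
    rw [level₀_tTilde]
    exact level₁_tTilde_app_pure F (𝓜.Ttilde.obj G) x y

/-- At level 1 both sides send `(x ⊗ y) ⊗ z` to the restriction of `φ x ⊗ (φ y ⊗ z)` along the
associator. The left side uses that of `Q`, the right side that of `M`, and `J` maps one to the
other. -/
theorem tTilde_assoc : (𝓜.tTilde (𝓜.lamTensor.obj F G) H).comp
      ((𝓜.lamTensor.assoc F G H).image 𝓜.Ttilde) =
    ((𝓜.lamTensor.assoc F G (𝓜.Ttilde.obj H)).comp
      (𝓜.lamTensor.tensorMap (eId Biset.{u} F) (𝓜.tTilde G H))).comp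
        (𝓜.tTilde F (𝓜.lamTensor.obj G H)) := by
  refine level_ext ?_ ?_
  · simp only [level₀_comp, level₀_tensorMap, level₀_tTilde, level₀_id, level₀_assoc,
      level₀_image]
    dsimp only [lamTensor_obj_zero, Ttilde_obj_zero]
    rw [Category.id_comp, PshMonoidal.map_id, Category.comp_id, Category.comp_id]
  · rw [level₁_comp, level₁_comp, level₁_comp, level₁_assoc, level₁_tensorMap, level₁_id]
    refine (dayMonoidal 𝓜.Obj).hom_ext₃ trivial (fun {a b c} x y z => ?_)
    refine (level₁_image_app (𝓜.lamTensor.assoc F G H) (op ((a ⊗ b) ⊗ c)) _).trans ?_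
    rw [level₀_assoc]
    refine (congrArg (fun w => ((reflMonoidal Q).assoc F.obj.zero G.obj.zero H.obj.zero).app
      (op ((a.ob ⊗ b.ob) ⊗ c.ob)) w) ((level₁_tTilde_app_pure (𝓜.lamTensor.obj F G) H
        ((dayMonoidal 𝓜.Obj).pure x y) z).trans (congrArg (fun w => (reflMonoidal Q).pure
          (P := (reflMonoidal Q).obj F.obj.zero G.obj.zero) (R := H.obj.zero) (a := a.ob ⊗ b.ob)
          (b := c.ob) w z) (lamTensor_str_app_pure F G x y)))).trans ?_
    refine ((reflMonoidal Q).assoc_app_pure _ _ _).trans ?_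
    -- Read backwards, this exhibits the element as a value of the outer strength, so that the rest
    -- of the comparison takes place over `M`.
    refine (level₁_tTilde_map_pure F (𝓜.lamTensor.obj G H) (α_ a b c).hom x
      ((reflMonoidal Q).pure (G.obj.str.app (op b) y) z)
      (𝓜.J_assoc a.ob b.ob c.ob)).symm.trans ?_
    refine congrArg (fun w => (level₁ (𝓜.tTilde F (𝓜.lamTensor.obj G H))).app
      (op ((a ⊗ b) ⊗ c)) w) ?_
    refine Eq.trans ?_ (congrArg (fun w => ((dayMonoidal 𝓜.Obj).map (𝟙 F.obj.one)
      (level₁ (𝓜.tTilde G H))).app (op ((a ⊗ b) ⊗ c)) w)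
        ((dayMonoidal 𝓜.Obj).assoc_app_pure x y z)).symm
    refine Eq.trans ?_ (psh_app_map ((dayMonoidal 𝓜.Obj).map (𝟙 F.obj.one)
      (level₁ (𝓜.tTilde G H))) (α_ a b c).hom _).symm
    exact congrArg (fun w => ((dayMonoidal 𝓜.Obj).obj F.obj.one
      (𝓜.Ttilde.obj (𝓜.lamTensor.obj G H)).obj.one).map (α_ a b c).hom.op
        ((dayMonoidal 𝓜.Obj).pure x w)) (level₁_tTilde_app_pure G H y z).symm

/-- The structure map of the unit `C(-, I)` is `J`. Both sides at level 1 restrict `y` along `J (i ▷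
b ≫ λ)`, as `J` preserves whiskering and unitors. -/
theorem tTilde_leftUnitor : (𝓜.tTilde 𝓜.lamTensor.unit F).comp
    ((𝓜.lamTensor.leftUnitor F).image 𝓜.Ttilde) = 𝓜.lamTensor.leftUnitor (𝓜.Ttilde.obj F) := by
  refine level_ext ?_ ?_
  · rw [level₀_comp, level₀_tTilde, level₀_image]
    exact Category.id_comp _
  · refine (dayMonoidal 𝓜.Obj).hom_ext trivial (fun {a b} (i : a ⟶ 𝟙_ 𝓜.Obj) y => ?_)
    refine Eq.trans ?_ ((dayMonoidal 𝓜.Obj).leftUnitor_app_pure trivial i y).symm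
    refine (level₁_image_app (𝓜.lamTensor.leftUnitor F) (op (a ⊗ b)) _).trans ?_
    refine (congrArg (fun w => (level₀ (𝓜.lamTensor.leftUnitor F)).app (op (a.ob ⊗ b.ob)) w)
      (level₁_tTilde_app_pure 𝓜.lamTensor.unit F i y)).trans ?_
    refine ((reflMonoidal Q).leftUnitor_app_pure F.prop (𝓜.functor.map i) y).trans ?_
    refine Eq.trans ?_ (Ttilde_obj_one_map F (i ▷ b ≫ (λ_ b).hom) y).symm
    refine congrArg (fun k => F.obj.zero.map (Quiver.Hom.op k) y) ?_
    refine ((𝓜.functor.map_comp (i ▷ b) (λ_ b).hom).trans ?_).symm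
    exact congrArg₂ (fun k l => k ≫ l) (J_whiskerRight i b) (𝓜.J_left b.ob)

variable (𝓜) in
/-- The costrength `T̃ F ⊗ G → T̃ (F ⊗ G)`. -/
noncomputable abbrev sTilde :=
  costrength (V := Biset.{u}) 𝓜.lamTensor 𝓜.Ttilde 𝓜.tTilde

theorem level₀_sTilde :
    level₀ (𝓜.sTilde F G) = 𝟙 ((reflMonoidal Q).obj F.obj.zero G.obj.zero) := by
  have h : level₀ (𝓜.sTilde F G) = ((reflMonoidal Q).braiding F.obj.zero G.obj.zero ≫
    level₀ (𝓜.tTilde G F)) ≫ (reflMonoidal Q).braiding G.obj.zero F.obj.zero := rfl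
  rw [h, level₀_tTilde]
  refine Eq.trans ?_ ((reflMonoidal Q).symmetry F.obj.zero G.obj.zero)
  exact congrArg (fun k => k ≫ (reflMonoidal Q).braiding G.obj.zero F.obj.zero)
    (Category.comp_id _)

/-- The first symmetry is taken over `M`. The strength carries it through `J` to the symmetry of
`Q`, where it cancels against the last one. -/
theorem level₁_sTilde_app_pure {a b : 𝓜.Obj} (x : F.obj.zero.obj (op a.ob))
    (y : G.obj.one.obj (op b)) :
    (level₁ (𝓜.sTilde F G)).app (op (a ⊗ b))
        ((dayMonoidal 𝓜.Obj).pure (P := (𝓜.Ttilde.obj F).obj.one) x y) =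
      (reflMonoidal Q).pure x (G.obj.str.app (op b) y) := by
  refine (level₁_image_app (𝓜.lamTensor.braiding G F) (op (a ⊗ b)) _).trans ?_
  rw [level₀_braiding]
  refine (congrArg (fun w => ((reflMonoidal Q).braiding G.obj.zero F.obj.zero).app
    (op (a.ob ⊗ b.ob)) w) ((congrArg (fun w => (level₁ (𝓜.tTilde G F)).app (op (a ⊗ b)) w)
      ((dayMonoidal 𝓜.Obj).braiding_app_pure (P := (𝓜.Ttilde.obj F).obj.one) x y)).trans
        (level₁_tTilde_map_pure G F (β_ a b).hom y x (𝓜.J_braid a.ob b.ob)))).trans ?_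
  exact (reflMonoidal Q).braiding_app_map_pure x _

theorem tTilde_commutative :
    ((𝓜.sTilde F (𝓜.Ttilde.obj G)).comp ((𝓜.tTilde F G).image 𝓜.Ttilde)).comp
        (𝓜.muTilde (𝓜.lamTensor.obj F G)) =
      ((𝓜.tTilde (𝓜.Ttilde.obj F) G).comp ((𝓜.sTilde F G).image 𝓜.Ttilde)).comp
        (𝓜.muTilde (𝓜.lamTensor.obj F G)) := by
  refine level_ext ?_ ?_
  · simp only [level₀_comp, level₀_image, level₀_tTilde, level₀_sTilde]
    rfl
  · refine (dayMonoidal 𝓜.Obj).hom_ext trivial (fun {a b} x y => ?_)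
    refine (level₁_image_app (𝓜.tTilde F G) (op (a ⊗ b)) _).trans (Eq.trans ?_
      (level₁_image_app (𝓜.sTilde F G) (op (a ⊗ b)) _).symm)
    -- On each side the second strength or costrength, lying under `T̃`, has become an identity. The
    -- first one gives `x ⊗ y` in either case, since the factor to which it applies `φ` lies in some
    -- `T̃ F` or `T̃ G`, whose structure map is the identity.
    rw [level₀_tTilde, level₀_sTilde]
    exact (level₁_sTilde_app_pure F (𝓜.Ttilde.obj G) x y).trans
      (level₁_tTilde_app_pure (𝓜.Ttilde.obj F) G x y).symm

variable (𝓜) in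
theorem Ttilde_isCommutativeStrongVMonad :
    IsCommutativeStrongVMonad 𝓜.lamTensor 𝓜.Ttilde 𝓜.etaTilde 𝓜.muTilde 𝓜.tTilde where
  monad := 𝓜.Ttilde_isVMonad
  strength :=
    { natural := tTilde_natural
      unit := tTilde_unit
      mul := tTilde_mul
      assoc := tTilde_assoc
      leftUnitor := tTilde_leftUnitor }
  commutative := tTilde_commutative

end Interpretation

theorem mainTheorem3 {Q : Type u} [Category.{u} Q] [MonoidalCategory Q] [SymmetricCategory Q]
    [∀ X : Q, PreservesColimitsOfShape (Discrete WalkingPair) (tensorRight X)]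
    (𝓜 : Interpretation Q) :
    𝓜.lamTensor.IsSymmetricMonoidal ∧
      IsCommutativeStrongVMonad 𝓜.lamTensor 𝓜.Ttilde 𝓜.etaTilde 𝓜.muTilde 𝓜.tTilde :=
  ⟨𝓜.lamTensor_isSymmetricMonoidal, 𝓜.Ttilde_isCommutativeStrongVMonad⟩
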